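/- Let $(M,g)$ and $(N,\tilde g)$ be smooth Riemannian manifolds (without boundary), with Levi-Civita connections $\overline\nabla$ and $\nabla$, and let $\pi:N\to M$ be a Riemannian submersion, i.e. a smooth surjective map such that for every $u\in N$ the differential $d\pi_u$ restricts to a linear isometry of the horizontal space $\mathcal H_uN:=(\ker d\pi_u)^\perp$ onto $T_{\pi(u)}M$. Suppose that the fibers of $\pi$ are totally geodesic (every geodesic of a fiber, for the induced metric, is a geodesic of $N$) and that the horizontal distribution $\mathcal H N$ is bracket-generating (at every $u\in N$ the tangent space $T_uN$ is spanned by the values at $u$ of iterated Lie brackets of smooth horizontal vector fields). Let $\Delta_M=\operatorname{div}\operatorname{grad}$ be the Laplace--Beltrami operator of $M$, and let $\Delta_{\mathcal H}h=\operatorname{div}_{\tilde g}\big((\operatorname{grad}h)_{\mathcal H}\big)$ be the horizontal Laplacian of $N$; here $(\cdot)_{\mathcal H}$ is the orthogonal projection to $\mathcal H N$ and $\operatorname{div}X=\operatorname{tr}(\nabla X)$, so that in local orthonormal frames $(E_i)$ of $\mathcal H N$ and $(F_j)$ of $\ker d\pi$ $$\Delta_{\mathcal H}=\sum_i\big(E_i^2-(\nabla_{E_i}E_i)_{\mathcal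 H}\big)-\sum_j(\nabla_{F_j}F_j)_{\mathcal H}.$$ Then $$\Delta_{\mathcal H}(f\circ\pi)=(\Delta_Mf)\circ\pi\qquad\text{for all } f\in C^\infty(M).$$ The corresponding identity also holds on the orthonormal frame bundle $\pi_{O(M)}:O(M)\to M$: with $d=\dim M$, $$\sum_{i=1}^d H_i^2\,(f\circ\pi_{O(M)})=(\Delta_Mf)\circ\pi_{O(M)}\qquad\text{for all } f\in C^\infty(M),$$ where $H_1,\dots,H_d$ are the canonical horizontal vector fields: $H_i(u)$, for a frame $u:\mathbb R^d\to T_pM$ at $p$, is the initial velocity of any horizontal curve $U$ in $O(M)$ with $U(0)=u$ and $(\pi_{O(M)}\circ U)'(0)=ue_i$, and a smooth curve $U$ of frames is horizontal if $U(t)e$ is parallel along $\pi_{O(M)}\circ U$ for every $e\in\mathbb R^d$. -/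

import Mathlib

open scoped Manifold ContDiff Bundle InnerProductSpace

noncomputable section

namespace RiemannianSubmersion

section Distribution

variable {E : Type*} [NormedAddCommGroup E] [NormedSpace ℝ E]
  {H : Type*} [TopologicalSpace H] (I : ModelWithCorners ℝ E H)
  {M : Type*} [TopologicalSpace M] [ChartedSpace H M]

/-- The velocity `γ'(t)` of a curve. -/
def velocity (γ : ℝ → M) (t : ℝ) : TangentSpace I (γ t) :=
  mfderiv 𝓘(ℝ, ℝ) I γ t (1 : ℝ)

/-- The vector fields obtained from the smooth sections of a distribution `Λ` by taking finitely
many iterated Lie brackets. -/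
inductive IsIteratedBracket [IsManifold I ∞ M] (Λ : Π x : M, Submodule ℝ (TangentSpace I x)) :
    (Π x : M, TangentSpace I x) → Prop
  | sect (X : Π x : M, TangentSpace I x)
      (smooth : ContMDiff I I.tangent ∞ (fun x ↦ (⟨x, X x⟩ : TangentBundle I M)))
      (mem : ∀ x, X x ∈ Λ x) : IsIteratedBracket Λ X
  | bracket (X Y : Π x : M, TangentSpace I x) (hX : IsIteratedBracket Λ X)
      (hY : IsIteratedBracket Λ Y) : IsIteratedBracket Λ (VectorField.mlieBracket I X Y)

/-- A distribution is bracket-generating if at every point the tangent space is spanned by the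
values of iterated Lie brackets of smooth sections of the distribution. -/
def IsBracketGenerating [IsManifold I ∞ M]
    (Λ : Π x : M, Submodule ℝ (TangentSpace I x)) : Prop :=
  ∀ x : M, Submodule.span ℝ {v | ∃ X, IsIteratedBracket I Λ X ∧ X x = v} = ⊤

end Distribution

section Riemannian

variable {E : Type*} [NormedAddCommGroup E] [NormedSpace ℝ E] [FiniteDimensional ℝ E]
  {H : Type*} [TopologicalSpace H] (I : ModelWithCorners ℝ E H)
  {M : Type*} [TopologicalSpace M] [ChartedSpace H M]

instance tangentSpace_finiteDimensional (x : M) : FiniteDimensional ℝ (TangentSpace I x) :=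
  inferInstanceAs (FiniteDimensional ℝ E)

variable [IsManifold I ∞ M] [Bundle.RiemannianBundle (fun x : M ↦ TangentSpace I x)]

/-- The right-hand side of Koszul's formula at `x`, divided by two: for differentiable vector
fields `X`, `Y`, `Z` this is `⟨∇_X Y, Z⟩` for the Levi-Civita connection `∇`. -/
def koszul (X Y Z : Π x : M, TangentSpace I x) (x : M) : ℝ :=
  (1 / 2 : ℝ) *
    (mvfderiv I (fun y ↦ ⟪Y y, Z y⟫_ℝ) x (X x)
      + mvfderiv I (fun y ↦ ⟪X y, Z y⟫_ℝ) x (Y x)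
      - mvfderiv I (fun y ↦ ⟪X y, Y y⟫_ℝ) x (Z x)
      - ⟪X x, VectorField.mlieBracket I Y Z x⟫_ℝ
      - ⟪Y x, VectorField.mlieBracket I X Z x⟫_ℝ
      + ⟪Z x, VectorField.mlieBracket I X Y x⟫_ℝ)

/-- The Levi-Civita connection: `leviCivita I X Y x` is `(∇_X Y)(x)`, for vector fields `X`, `Y`
that are differentiable at `x`. It is the vector determined by Koszul's formula, whose right-hand
side is tensorial in the last argument and is tested here against extensions of the vectors of an
orthonormal basis of the tangent space (`FiberBundle.extend` takes the extension with constant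
coordinates in the chart at `x`). -/
def leviCivita (X Y : Π x : M, TangentSpace I x) (x : M) : TangentSpace I x :=
  ∑ i, koszul I X Y (FiberBundle.extend E (stdOrthonormalBasis ℝ (TangentSpace I x) i)) x •
    stdOrthonormalBasis ℝ (TangentSpace I x) i

/-- The covariant derivative `∇_v Y` of a vector field `Y` (differentiable at `x`) along a tangent
vector `v` at `x`. -/
def covDeriv (Y : Π x : M, TangentSpace I x) (x : M) (v : TangentSpace I x) : TangentSpace I x :=
  leviCivita I (FiberBundle.extend E v) Y x

/-- The divergence `tr (∇ X)` of a vector field `X`. -/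
def divergence (X : Π x : M, TangentSpace I x) (x : M) : ℝ :=
  ∑ i, ⟪covDeriv I X x (stdOrthonormalBasis ℝ (TangentSpace I x) i),
    stdOrthonormalBasis ℝ (TangentSpace I x) i⟫_ℝ

/-- The Riemannian gradient, `⟨grad f, v⟩ = df(v)`. -/
def grad (f : M → ℝ) (x : M) : TangentSpace I x :=
  (InnerProductSpace.toDual ℝ (TangentSpace I x)).symm (mvfderiv I f x)

/-- The Laplace-Beltrami operator `div grad`. -/
def laplaceBeltrami (f : M → ℝ) (x : M) : ℝ :=
  divergence I (grad I f) x

/-- The covariant derivative `(D_t V)(t)` of a vector field `V` along a curve `γ`: in the coordinates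
of the chart at `γ t`, with coordinate fields `∂_k`, it is `V̇ᵏ ∂_k + Vᵏ ∇_{γ'(t)} ∂_k`. -/
def covDerivAlong (γ : ℝ → M) (V : Π t : ℝ, TangentSpace I (γ t)) (t : ℝ) :
    TangentSpace I (γ t) :=
  (trivializationAt E (TangentSpace I) (γ t)).symm (γ t)
      (deriv (fun s ↦ (trivializationAt E (TangentSpace I) (γ t)
        (⟨γ s, V s⟩ : TangentBundle I M)).2) t)
    + covDeriv I (FiberBundle.extend E (V t)) (γ t) (velocity I γ t)

/-- The acceleration `D_t γ'` of a curve. -/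
def acceleration (γ : ℝ → M) (t : ℝ) : TangentSpace I (γ t) :=
  covDerivAlong I γ (velocity I γ) t

/-- `γ` restricted to the interval `J` is a geodesic. -/
def IsGeodesicOn (γ : ℝ → M) (J : Set ℝ) : Prop :=
  ContMDiffOn 𝓘(ℝ, ℝ) I ∞ γ J ∧ ∀ t ∈ J, acceleration I γ t = 0

end Riemannian

section Submersion

variable {E : Type*} [NormedAddCommGroup E] [NormedSpace ℝ E] [FiniteDimensional ℝ E]
  {H : Type*} [TopologicalSpace H] (I : ModelWithCorners ℝ E H)
  {M : Type*} [TopologicalSpace M] [ChartedSpace H M]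
  [IsManifold I ∞ M] [Bundle.RiemannianBundle (fun x : M ↦ TangentSpace I x)]
  {E' : Type*} [NormedAddCommGroup E'] [NormedSpace ℝ E'] [FiniteDimensional ℝ E']
  {H' : Type*} [TopologicalSpace H'] (I' : ModelWithCorners ℝ E' H')
  {N : Type*} [TopologicalSpace N] [ChartedSpace H' N]
  [IsManifold I' ∞ N] [Bundle.RiemannianBundle (fun x : N ↦ TangentSpace I' x)]

/-- The vertical subspace `ker d(pr)_u`. -/
def verticalSpace (pr : N → M) (u : N) : Submodule ℝ (TangentSpace I' u) :=
  (mfderiv I' I pr u).ker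

/-- The horizontal subspace `(ker d(pr)_u)ᗮ`. -/
def horizontalSpace (pr : N → M) (u : N) : Submodule ℝ (TangentSpace I' u) :=
  (verticalSpace I I' pr u)ᗮ

/-- A Riemannian submersion: a smooth surjective map whose differential restricts at every point
to a linear isometry of the horizontal space onto the tangent space of the base. -/
structure IsRiemannianSubmersion (pr : N → M) : Prop where
  contMDiff : ContMDiff I' I ∞ pr
  surjective : Function.Surjective pr
  bijOn : ∀ u, Set.BijOn (mfderiv I' I pr u) (horizontalSpace I I' pr u) Set.univ
  isometry : ∀ u, ∀ v ∈ horizontalSpace I I' pr u, ∀ w ∈ horizontalSpace I I' pr u,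
    ⟪mfderiv I' I pr u v, mfderiv I' I pr u w⟫_ℝ = ⟪v, w⟫_ℝ

/-- `γ` restricted to the interval `J` is a geodesic of a fiber of `pr`, for the metric induced on
the fiber. The Levi-Civita connection of the induced metric is the tangential (here: vertical) part
of the ambient one, so this says that the acceleration of `γ` has no vertical part. -/
def IsFiberGeodesicOn (pr : N → M) (γ : ℝ → N) (J : Set ℝ) : Prop :=
  ContMDiffOn 𝓘(ℝ, ℝ) I' ∞ γ J ∧ (∃ p : M, ∀ t ∈ J, pr (γ t) = p) ∧
    ∀ t ∈ J, (verticalSpace I I' pr (γ t)).starProjection (acceleration I' γ t) = 0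

/-- The fibers are totally geodesic: every geodesic of a fiber is a geodesic of the total space. -/
def HasTotallyGeodesicFibers (pr : N → M) : Prop :=
  ∀ (γ : ℝ → N) (J : Set ℝ), IsOpen J → J.OrdConnected →
    IsFiberGeodesicOn I I' pr γ J → IsGeodesicOn I' γ J

/-- The horizontal part `(grad f)_𝓗` of the gradient of a function on the total space. -/
def horizontalGrad (pr : N → M) (f : N → ℝ) (u : N) : TangentSpace I' u :=
  (horizontalSpace I I' pr u).starProjection (grad I' f u)

/-- The horizontal Laplacian `div ((grad f)_𝓗)`, the generator of the pre-Dirichlet form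
`(f, h) ↦ -∫ ⟨(grad f)_𝓗, (grad h)_𝓗⟩ dVol`. Evaluating the trace of `∇ (grad f)_𝓗` in local
orthonormal frames `E_i` of the horizontal and `F_j` of the vertical bundle gives
`∑ i, (E_i² - (∇_{E_i} E_i)_𝓗) f - ∑ j, (∇_{F_j} F_j)_𝓗 f`. -/
def horizontalLaplacian (pr : N → M) (f : N → ℝ) (u : N) : ℝ :=
  divergence I' (horizontalGrad I I' pr f) u

end Submersion

section FrameBundle

variable {d : ℕ} {M : Type*} [TopologicalSpace M] [ChartedSpace (EuclideanSpace ℝ (Fin d)) M]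
  [IsManifold (𝓡 d) ∞ M] [Bundle.RiemannianBundle (fun x : M ↦ TangentSpace (𝓡 d) x)]

variable (d M) in
/-- The orthonormal frame bundle `O(M)`: pairs of a point and an orthonormal basis of the tangent
space there. A frame `u` at `p` is also the isometry `e ↦ u e` from `ℝᵈ` to the tangent space. -/
abbrev FrameBundle : Type _ :=
  Σ p : M, OrthonormalBasis (Fin d) ℝ (TangentSpace (𝓡 d) p)

/-- A curve `U` of frames, restricted to the interval `J`, is smooth and horizontal: for every
`e ∈ ℝᵈ` the vector field `U(t) e` is smooth and parallel along the base curve. -/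
def IsHorizontalCurveOn (U : ℝ → FrameBundle d M) (J : Set ℝ) : Prop :=
  ∀ e : EuclideanSpace ℝ (Fin d),
    ContMDiffOn 𝓘(ℝ, ℝ) (𝓡 d).tangent ∞
      (fun t ↦ (⟨(U t).1, (U t).2.repr.symm e⟩ : TangentBundle (𝓡 d) M)) J ∧
    ∀ t ∈ J, covDerivAlong (𝓡 d) (fun t ↦ (U t).1) (fun t ↦ (U t).2.repr.symm e) t = 0

/-- `U` is, near time `0`, a horizontal curve in `O(M)` that starts at `u` and whose base curve has
initial velocity `u e_i`; so its initial velocity is the canonical horizontal vector `H_i(u)`. -/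
def IsHorizontalCurveFrom (i : Fin d) (u : FrameBundle d M) (U : ℝ → FrameBundle d M) : Prop :=
  (∃ ε > 0, IsHorizontalCurveOn U (Set.Ioo (-ε) ε)) ∧ U 0 = u ∧
    velocity (𝓡 d) (fun t ↦ (U t).1) 0 = (U 0).2 i

/-- `G = H_i F`, where `H_i` is the `i`-th canonical horizontal vector field on `O(M)`: the
derivative of `F` at `u` along the horizontal curves with initial velocity `H_i(u)` is `G u`. -/
def IsHorizontalDeriv (i : Fin d) (F G : FrameBundle d M → ℝ) : Prop :=
  ∀ u, (∃ U, IsHorizontalCurveFrom i u U) ∧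
    ∀ U, IsHorizontalCurveFrom i u U → HasDerivAt (fun t ↦ F (U t)) (G u) 0

/-- `L = Δ_𝓗 F` for the horizontal Laplacian `Δ_𝓗 = ∑ i, H_i²` of the frame bundle. -/
def IsFrameHorizontalLaplacian (F L : FrameBundle d M → ℝ) : Prop :=
  ∃ G K : Fin d → FrameBundle d M → ℝ,
    (∀ i, IsHorizontalDeriv i F (G i)) ∧ (∀ i, IsHorizontalDeriv i (G i) (K i)) ∧
      ∀ u, L u = ∑ i, K i u

end FrameBundle

end RiemannianSubmersion

end

namespace RiemannianSubmersion

set_option linter.unusedSectionVars false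

open FiberBundle VectorField

section LeviCivita

variable {E : Type*} [NormedAddCommGroup E] [NormedSpace ℝ E] [FiniteDimensional ℝ E]
  {M : Type*} [TopologicalSpace M] [ChartedSpace E M] [IsManifold 𝓘(ℝ, E) ∞ M]
  [Bundle.RiemannianBundle (fun x : M ↦ TangentSpace 𝓘(ℝ, E) x)]
  [IsContMDiffRiemannianBundle 𝓘(ℝ, E) ∞ E (fun x : M ↦ TangentSpace 𝓘(ℝ, E) x)]

/-- The inner product of two differentiable vector fields along a map is differentiable. -/
theorem mdifferentiableAt_inner {F : Type*} [NormedAddCommGroup F] [NormedSpace ℝ F]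
    {G : Type*} [TopologicalSpace G] {J : ModelWithCorners ℝ F G}
    {P : Type*} [TopologicalSpace P] [ChartedSpace G P] {b : P → M}
    {V W : Π p, TangentSpace 𝓘(ℝ, E) (b p)} {p : P}
    (hV : MDifferentiableAt J 𝓘(ℝ, E).tangent (fun q ↦ (⟨b q, V q⟩ : TangentBundle 𝓘(ℝ, E) M)) p)
    (hW : MDifferentiableAt J 𝓘(ℝ, E).tangent (fun q ↦ (⟨b q, W q⟩ : TangentBundle 𝓘(ℝ, E) M)) p) :
    MDifferentiableAt J 𝓘(ℝ, ℝ) (fun q ↦ ⟪V q, W q⟫_ℝ) p :=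
  MDifferentiableAt.inner_bundle (F := E) (E := fun x : M ↦ TangentSpace 𝓘(ℝ, E) x)
    (IB := 𝓘(ℝ, E)) hV hW

theorem tensorialAt_koszul_right {X Y : Π x : M, TangentSpace 𝓘(ℝ, E) x} {x : M}
    (hX : MDiffAt (T% X) x) (hY : MDiffAt (T% Y) x) :
    TensorialAt 𝓘(ℝ, E) E (fun Z ↦ koszul 𝓘(ℝ, E) X Y Z x) x where
  smul {f Z} hf hZ := by
    have hYZ := mdifferentiableAt_inner hY hZ
    have hXZ := mdifferentiableAt_inner hX hZ
    have : CompleteSpace E := FiniteDimensional.complete ℝ E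
    simp only [koszul, Pi.smul_apply', inner_smul_right, mvfderiv_fun_mul hf hYZ,
      mvfderiv_fun_mul hf hXZ, mlieBracket_smul_right hf hZ, inner_add_right, inner_smul_left]
    simp
    ring
  add {Z Z'} hZ hZ' := by
    have : CompleteSpace E := FiniteDimensional.complete ℝ E
    simp only [koszul, Pi.add_apply, inner_add_right, inner_add_left,
      mvfderiv_fun_add (mdifferentiableAt_inner hY hZ) (mdifferentiableAt_inner hY hZ'),
      mvfderiv_fun_add (mdifferentiableAt_inner hX hZ) (mdifferentiableAt_inner hX hZ'),
      mlieBracket_add_right hZ hZ']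
    simp
    ring

theorem tensorialAt_koszul_left {Y Z : Π x : M, TangentSpace 𝓘(ℝ, E) x} {x : M}
    (hY : MDiffAt (T% Y) x) (hZ : MDiffAt (T% Z) x) :
    TensorialAt 𝓘(ℝ, E) E (fun X ↦ koszul 𝓘(ℝ, E) X Y Z x) x where
  smul {f X} hf hX := by
    have hXY := mdifferentiableAt_inner hX hY
    have hXZ := mdifferentiableAt_inner hX hZ
    have : CompleteSpace E := FiniteDimensional.complete ℝ E
    simp only [koszul, Pi.smul_apply', inner_smul_left, mvfderiv_fun_mul hf hXY,
      mvfderiv_fun_mul hf hXZ, mlieBracket_smul_left hf hX, inner_add_right, inner_smul_right,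
      RCLike.conj_to_real]
    simp [real_inner_comm]
    ring
  add {X X'} hX hX' := by
    have : CompleteSpace E := FiniteDimensional.complete ℝ E
    simp only [koszul, Pi.add_apply, inner_add_right, inner_add_left,
      mvfderiv_fun_add (mdifferentiableAt_inner hX hY) (mdifferentiableAt_inner hX' hY),
      mvfderiv_fun_add (mdifferentiableAt_inner hX hZ) (mdifferentiableAt_inner hX' hZ),
      mlieBracket_add_left hX hX']
    simp
    ring

theorem mdifferentiableAt_extend_tangent {x : M} (v : TangentSpace 𝓘(ℝ, E) x) :
    MDiffAt (T% (extend E v)) x :=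
  mdifferentiableAt_extend 𝓘(ℝ, E) E v

/-- The defining property of the Levi-Civita connection. -/
theorem inner_leviCivita {X Y Z : Π x : M, TangentSpace 𝓘(ℝ, E) x} {x : M}
    (hX : MDiffAt (T% X) x) (hY : MDiffAt (T% Y) x) (hZ : MDiffAt (T% Z) x) :
    ⟪leviCivita 𝓘(ℝ, E) X Y x, Z x⟫_ℝ = koszul 𝓘(ℝ, E) X Y Z x := by
  have h := tensorialAt_koszul_right hX hY
  rw [leviCivita, sum_inner, ← h.mkHom_apply hZ]
  conv_rhs => rw [← (stdOrthonormalBasis ℝ (TangentSpace 𝓘(ℝ, E) x)).sum_repr' (Z x), map_sum]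
  refine Finset.sum_congr rfl fun i _ ↦ ?_
  rw [map_smul, inner_smul_left, h.mkHom_apply_eq_extend, RCLike.conj_to_real, smul_eq_mul,
    mul_comm]

theorem inner_covDeriv {Y X Z : Π x : M, TangentSpace 𝓘(ℝ, E) x} {x : M}
    (hX : MDiffAt (T% X) x) (hY : MDiffAt (T% Y) x) (hZ : MDiffAt (T% Z) x) :
    ⟪covDeriv 𝓘(ℝ, E) Y x (X x), Z x⟫_ℝ = koszul 𝓘(ℝ, E) X Y Z x := by
  rw [covDeriv, inner_leviCivita (mdifferentiableAt_extend_tangent _) hY hZ]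
  exact (tensorialAt_koszul_left hY hZ).pointwise (mdifferentiableAt_extend_tangent _) hX (by simp)

theorem koszul_add_koszul_swap (X Y Z : Π x : M, TangentSpace 𝓘(ℝ, E) x) (x : M) :
    koszul 𝓘(ℝ, E) X Y Z x + koszul 𝓘(ℝ, E) X Z Y x =
      mvfderiv 𝓘(ℝ, E) (fun y ↦ ⟪Y y, Z y⟫_ℝ) x (X x) := by
  have h1 : (fun y ↦ ⟪Z y, Y y⟫_ℝ) = fun y ↦ ⟪Y y, Z y⟫_ℝ :=
    funext fun y ↦ real_inner_comm _ _
  rw [koszul, koszul, h1, mlieBracket_swap_apply (V := Z) (W := Y), inner_neg_right]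
  ring

theorem koszul_sub_koszul_swap (X Y Z : Π x : M, TangentSpace 𝓘(ℝ, E) x) (x : M) :
    koszul 𝓘(ℝ, E) X Y Z x - koszul 𝓘(ℝ, E) Y X Z x =
      ⟪mlieBracket 𝓘(ℝ, E) X Y x, Z x⟫_ℝ := by
  have h1 : (fun y ↦ ⟪X y, Y y⟫_ℝ) = fun y ↦ ⟪Y y, X y⟫_ℝ :=
    funext fun y ↦ real_inner_comm _ _
  rw [koszul, koszul, h1, mlieBracket_swap_apply (V := Y) (W := X), inner_neg_right,
    real_inner_comm (Z x)]
  ring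

/-- The Levi-Civita connection is compatible with the metric. -/
theorem mvfderiv_inner {Y Z : Π x : M, TangentSpace 𝓘(ℝ, E) x} {x : M}
    (hY : MDiffAt (T% Y) x) (hZ : MDiffAt (T% Z) x) (v : TangentSpace 𝓘(ℝ, E) x) :
    mvfderiv 𝓘(ℝ, E) (fun y ↦ ⟪Y y, Z y⟫_ℝ) x v =
      ⟪covDeriv 𝓘(ℝ, E) Y x v, Z x⟫_ℝ + ⟪Y x, covDeriv 𝓘(ℝ, E) Z x v⟫_ℝ := by
  have hv := mdifferentiableAt_extend_tangent v
  have h1 := inner_covDeriv hv hY hZ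
  have h2 := inner_covDeriv hv hZ hY
  have h3 := koszul_add_koszul_swap (extend E v) Y Z x
  rw [extend_apply_self] at h1 h2 h3
  rw [h1, real_inner_comm, h2, h3]

/-- The covariant derivative of a vector field at a point as a linear map. -/
noncomputable def covDerivLinear (Y : Π x : M, TangentSpace 𝓘(ℝ, E) x) (x : M)
    (hY : MDiffAt (T% Y) x) : TangentSpace 𝓘(ℝ, E) x →ₗ[ℝ] TangentSpace 𝓘(ℝ, E) x where
  toFun := covDeriv 𝓘(ℝ, E) Y x
  map_add' v w := by
    refine ext_inner_right ℝ fun z ↦ ?_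
    have hz := mdifferentiableAt_extend_tangent z
    have key (v : TangentSpace 𝓘(ℝ, E) x) : ⟪covDeriv 𝓘(ℝ, E) Y x v, z⟫_ℝ =
        TensorialAt.mkHom _ x (tensorialAt_koszul_left hY hz) v := by
      have := inner_covDeriv (mdifferentiableAt_extend_tangent v) hY hz
      simp only [extend_apply_self] at this
      rw [this, TensorialAt.mkHom_apply_eq_extend]
    rw [inner_add_left, key, key, key, map_add]
  map_smul' c v := by
    refine ext_inner_right ℝ fun z ↦ ?_
    have hz := mdifferentiableAt_extend_tangent z
    have key (v : TangentSpace 𝓘(ℝ, E) x) : ⟪covDeriv 𝓘(ℝ, E) Y x v, z⟫_ℝ =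
        TensorialAt.mkHom _ x (tensorialAt_koszul_left hY hz) v := by
      have := inner_covDeriv (mdifferentiableAt_extend_tangent v) hY hz
      simp only [extend_apply_self] at this
      rw [this, TensorialAt.mkHom_apply_eq_extend]
    rw [RingHom.id_apply, inner_smul_left, key, key, map_smul]
    simp

theorem divergence_eq_trace {Y : Π x : M, TangentSpace 𝓘(ℝ, E) x} {x : M}
    (hY : MDiffAt (T% Y) x) :
    divergence 𝓘(ℝ, E) Y x = LinearMap.trace ℝ _ (covDerivLinear Y x hY) := by
  rw [LinearMap.trace_eq_sum_inner _ (stdOrthonormalBasis ℝ (TangentSpace 𝓘(ℝ, E) x))]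
  exact Finset.sum_congr rfl fun i _ ↦ real_inner_comm _ _

end LeviCivita

section Frame

variable {E : Type*} [NormedAddCommGroup E] [NormedSpace ℝ E] [FiniteDimensional ℝ E]
  {M : Type*} [TopologicalSpace M] [ChartedSpace E M] [IsManifold 𝓘(ℝ, E) ∞ M]

theorem minSmoothness_two_le_infty : minSmoothness ℝ 2 ≤ ∞ := by
  simp only [minSmoothness_of_isRCLikeNormedField]
  exact WithTop.coe_le_coe.2 le_top

/-- The vector field with constant coordinates `v` in the chart at `x₀`. -/
noncomputable def frame (x₀ : M) (v : E) (x : M) : TangentSpace 𝓘(ℝ, E) x :=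
  (trivializationAt E (TangentSpace 𝓘(ℝ, E)) x₀).symm x v

/-- The coordinates of a tangent vector in the chart at `x₀`. -/
noncomputable def coord (x₀ : M) {x : M} (w : TangentSpace 𝓘(ℝ, E) x) : E :=
  (trivializationAt E (TangentSpace 𝓘(ℝ, E)) x₀ (⟨x, w⟩ : TangentBundle 𝓘(ℝ, E) M)).2

variable {x₀ x : M}

theorem frame_eq_symmL (hx : x ∈ (chartAt E x₀).source) (v : E) :
    frame x₀ v x = (trivializationAt E (TangentSpace 𝓘(ℝ, E)) x₀).symmL ℝ x v :=
  (Bundle.Trivialization.symmL_apply _ (by simpa using hx) v).symm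

theorem frame_add (hx : x ∈ (chartAt E x₀).source) (v w : E) :
    frame x₀ (v + w) x = frame x₀ v x + frame x₀ w x := by
  simp only [frame_eq_symmL hx, map_add]

theorem coord_frame (hx : x ∈ (chartAt E x₀).source) (v : E) : coord x₀ (frame x₀ v x) = v := by
  have : x ∈ (trivializationAt E (TangentSpace 𝓘(ℝ, E)) x₀).baseSet := by simpa using hx
  rw [coord, frame, Bundle.Trivialization.apply_mk_symm _ this]

theorem frame_coord (hx : x ∈ (chartAt E x₀).source) (w : TangentSpace 𝓘(ℝ, E) x) :
    frame x₀ (coord x₀ w) x = w := by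
  have : x ∈ (trivializationAt E (TangentSpace 𝓘(ℝ, E)) x₀).baseSet := by simpa using hx
  rw [coord, frame, Bundle.Trivialization.symm_apply_apply_mk _ this]

theorem coord_eq_mfderiv (hx : x ∈ (chartAt E x₀).source) (w : TangentSpace 𝓘(ℝ, E) x) :
    coord x₀ w = mfderiv 𝓘(ℝ, E) 𝓘(ℝ, E) (extChartAt 𝓘(ℝ, E) x₀) x w := by
  have hx' : x ∈ (trivializationAt E (TangentSpace 𝓘(ℝ, E)) x₀).baseSet := by simpa using hx
  have h : coord x₀ w =
      (trivializationAt E (TangentSpace 𝓘(ℝ, E)) x₀).continuousLinearMapAt ℝ x w := by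
    rw [Bundle.Trivialization.continuousLinearMapAt_apply, Bundle.Trivialization.linearMapAt_apply,
      if_pos hx', coord]
  exact h.trans (DFunLike.congr_fun (TangentBundle.continuousLinearMapAt_trivializationAt hx) w)

theorem contMDiffAt_frame (hx : x ∈ (chartAt E x₀).source) (v : E) :
    ContMDiffAt 𝓘(ℝ, E) 𝓘(ℝ, E).tangent ∞ (T% (frame x₀ v)) x := by
  have hx' : x ∈ (trivializationAt E (TangentSpace 𝓘(ℝ, E)) x₀).baseSet := by simpa using hx
  rw [(trivializationAt E (TangentSpace 𝓘(ℝ, E)) x₀).contMDiffAt_section_iff (IB := 𝓘(ℝ, E)) hx']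
  refine (contMDiffAt_const (c := v)).congr_of_eventuallyEq ?_
  filter_upwards [(chartAt E x₀).open_source.mem_nhds hx] with y hy using coord_frame hy v

theorem mdifferentiableAt_frame (hx : x ∈ (chartAt E x₀).source) (v : E) :
    MDiffAt (T% (frame x₀ v)) x :=
  (contMDiffAt_frame hx v).mdifferentiableAt (by simp)

theorem contMDiffAt_extChartAt_symm {y : E} (hy : y ∈ (extChartAt 𝓘(ℝ, E) x₀).target) :
    ContMDiffAt 𝓘(ℝ, E) 𝓘(ℝ, E) ∞ (extChartAt 𝓘(ℝ, E) x₀).symm y :=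
  (contMDiffOn_extChartAt_symm x₀).contMDiffAt ((isOpen_extChartAt_target x₀).mem_nhds hy)

theorem symm_mem_chart_source {y : E} (hy : y ∈ (extChartAt 𝓘(ℝ, E) x₀).target) :
    (extChartAt 𝓘(ℝ, E) x₀).symm y ∈ (chartAt E x₀).source := by
  rw [← extChartAt_source 𝓘(ℝ, E)]
  exact (extChartAt 𝓘(ℝ, E) x₀).map_target hy

theorem extChartAt_mem_target (hx : x ∈ (chartAt E x₀).source) :
    extChartAt 𝓘(ℝ, E) x₀ x ∈ (extChartAt 𝓘(ℝ, E) x₀).target :=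
  (extChartAt 𝓘(ℝ, E) x₀).map_source (by rwa [extChartAt_source])

theorem extChartAt_symm_extChartAt (hx : x ∈ (chartAt E x₀).source) :
    (extChartAt 𝓘(ℝ, E) x₀).symm (extChartAt 𝓘(ℝ, E) x₀ x) = x :=
  (extChartAt 𝓘(ℝ, E) x₀).left_inv (by rwa [extChartAt_source])

theorem frame_eq_mfderiv_symm {y : E} (hy : y ∈ (extChartAt 𝓘(ℝ, E) x₀).target) (v : E) :
    frame x₀ v ((extChartAt 𝓘(ℝ, E) x₀).symm y) =
      mfderiv 𝓘(ℝ, E) 𝓘(ℝ, E) (extChartAt 𝓘(ℝ, E) x₀).symm y v := by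
  have hx := symm_mem_chart_source hy
  rw [frame_eq_symmL hx]
  refine (DFunLike.congr_fun (TangentBundle.symmL_trivializationAt hx) v).trans ?_
  rw [(extChartAt _ _).right_inv hy, modelWithCornersSelf_coe, Set.range_id, mfderivWithin_univ]
  rfl

theorem mvfderiv_frame {h : M → ℝ} (hx : x ∈ (chartAt E x₀).source) (hh : MDiffAt h x) (v : E) :
    mvfderiv 𝓘(ℝ, E) h x (frame x₀ v x) =
      fderiv ℝ (h ∘ (extChartAt 𝓘(ℝ, E) x₀).symm) (extChartAt 𝓘(ℝ, E) x₀ x) v := by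
  have hx1 : x ∈ (extChartAt 𝓘(ℝ, E) x₀).source := by rwa [extChartAt_source]
  have hy := (extChartAt 𝓘(ℝ, E) x₀).map_source hx1
  obtain ⟨y, hy', rfl⟩ : ∃ y ∈ (extChartAt 𝓘(ℝ, E) x₀).target,
      (extChartAt 𝓘(ℝ, E) x₀).symm y = x := ⟨_, hy, (extChartAt 𝓘(ℝ, E) x₀).left_inv hx1⟩
  rw [(extChartAt 𝓘(ℝ, E) x₀).right_inv hy', frame_eq_mfderiv_symm hy']
  refine (mvfderiv_comp_apply y hh
    ((contMDiffAt_extChartAt_symm hy').mdifferentiableAt (by simp)) v).symm.trans ?_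
  exact DFunLike.congr_fun (mfderiv_eq_fderiv (𝕜 := ℝ)) v

theorem mlieBracket_frame (hx : x ∈ (chartAt E x₀).source) (v w : E) :
    mlieBracket 𝓘(ℝ, E) (frame x₀ v) (frame x₀ w) x = 0 := by
  have : CompleteSpace E := FiniteDimensional.complete ℝ E
  have : IsManifold 𝓘(ℝ, E) (minSmoothness ℝ 2) M := by simpa using inferInstanceAs (IsManifold 𝓘(ℝ, E) 2 M)
  let c (v : E) : Π y : E, TangentSpace 𝓘(ℝ, E) y := fun _ ↦ v
  have key (v : E) : frame x₀ v =ᶠ[nhds x]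
      mpullback 𝓘(ℝ, E) 𝓘(ℝ, E) (extChartAt 𝓘(ℝ, E) x₀) (c v) := by
    filter_upwards [(chartAt E x₀).open_source.mem_nhds hx] with y hy
    have hi := isInvertible_mfderiv_extChartAt (I := 𝓘(ℝ, E)) (x := x₀) (y := y) (by simpa using hy)
    have h1 : c v _ = mfderiv 𝓘(ℝ, E) 𝓘(ℝ, E) (extChartAt 𝓘(ℝ, E) x₀) y (frame x₀ v y) :=
      (coord_frame hy v).symm.trans (coord_eq_mfderiv hy _)
    exact (hi.inverse_apply_eq.2 h1).symm
  have hc (v y : E) : MDiffAt (T% (c v)) y :=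
    (contMDiffAt_vectorSpace_iff_contDiffAt.2 (contDiffAt_const (c := v))).mdifferentiableAt
      one_ne_zero
  have hb : mlieBracket 𝓘(ℝ, E) (c v) (c w) = 0 := by
    ext y
    rw [← mlieBracketWithin_univ, mlieBracketWithin_eq_lieBracketWithin, lieBracketWithin_univ, lieBracket]
    simp only [fderiv_fun_const]
    exact sub_self _
  rw [(key v).mlieBracket_vectorField_eq (key w)]
  refine (mpullback_mlieBracket (n := ∞) (hc v _) (hc w _) (contMDiffAt_extChartAt' hx)
    minSmoothness_two_le_infty).symm.trans ?_
  rw [hb, mpullback_zero]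
  rfl

theorem velocity_eq_frame {γ : ℝ → M} {t : ℝ} (ht : γ t ∈ (chartAt E x₀).source)
    (hγ : MDifferentiableAt 𝓘(ℝ, ℝ) 𝓘(ℝ, E) γ t) :
    velocity 𝓘(ℝ, E) γ t = frame x₀ (deriv (extChartAt 𝓘(ℝ, E) x₀ ∘ γ) t) (γ t) := by
  rw [← frame_coord ht (velocity 𝓘(ℝ, E) γ t), coord_eq_mfderiv ht, velocity]
  congr 1
  have h1 := mfderiv_comp t (mdifferentiableAt_extChartAt (I := 𝓘(ℝ, E)) ht) hγ
  rw [mfderiv_eq_fderiv] at h1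
  exact (DFunLike.congr_fun h1 (1 : ℝ)).symm

theorem hasDerivAt_comp_curve {h : M → ℝ} {γ : ℝ → M} {t : ℝ} (hh : MDiffAt h (γ t))
    (hγ : MDifferentiableAt 𝓘(ℝ, ℝ) 𝓘(ℝ, E) γ t) :
    HasDerivAt (fun s ↦ h (γ s)) (mvfderiv 𝓘(ℝ, E) h (γ t) (velocity 𝓘(ℝ, E) γ t)) t := by
  have h1 : HasFDerivAt (h ∘ γ) (fderiv ℝ (h ∘ γ) t) t :=
    (hh.comp t hγ).differentiableAt.hasFDerivAt
  have h2 : fderiv ℝ (h ∘ γ) t (1 : ℝ) =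
      mvfderiv 𝓘(ℝ, E) h (γ t) (velocity 𝓘(ℝ, E) γ t) :=
    (DFunLike.congr_fun (mfderiv_eq_fderiv (𝕜 := ℝ)) (1 : ℝ)).symm.trans
      (mvfderiv_comp_apply t hh hγ (1 : ℝ))
  exact h2 ▸ h1.hasDerivAt

end Frame

section ChartMetric

variable {E : Type*} [NormedAddCommGroup E] [NormedSpace ℝ E] [FiniteDimensional ℝ E]
  {M : Type*} [TopologicalSpace M] [ChartedSpace E M] [IsManifold 𝓘(ℝ, E) ∞ M]
  [Bundle.RiemannianBundle (fun x : M ↦ TangentSpace 𝓘(ℝ, E) x)]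
  [IsContMDiffRiemannianBundle 𝓘(ℝ, E) ∞ E (fun x : M ↦ TangentSpace 𝓘(ℝ, E) x)]

theorem contDiffOn_dual {F V : Type*} [NormedAddCommGroup F] [NormedSpace ℝ F]
    [NormedAddCommGroup V] [NormedSpace ℝ V] {n : WithTop ℕ∞} {f : F → E →L[ℝ] V} {s : Set F}
    (h : ∀ v, ContDiffOn ℝ n (fun y ↦ f y v) s) : ContDiffOn ℝ n f s :=
  contDiffOn_clm_apply.2 h

/-- The metric in the coordinates of the chart at `x₀`. -/
noncomputable def chartMetric (x₀ : M) (y : E) : E →L[ℝ] E →L[ℝ] ℝ :=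
  let L : E →L[ℝ] TangentSpace 𝓘(ℝ, E) ((extChartAt 𝓘(ℝ, E) x₀).symm y) :=
    (trivializationAt E (TangentSpace 𝓘(ℝ, E)) x₀).symmL ℝ ((extChartAt 𝓘(ℝ, E) x₀).symm y)
  (innerSL ℝ).bilinearComp L L

/-- The Christoffel symbols of the first kind in the chart at `x₀`. -/
noncomputable def chartKoszul (x₀ : M) (y v w : E) : E →L[ℝ] ℝ :=
  (1 / 2 : ℝ) • (fderiv ℝ (chartMetric x₀) y v w + fderiv ℝ (chartMetric x₀) y w v -
    ((fderiv ℝ (chartMetric x₀) y).flip v).flip w)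

/-- The Christoffel symbols in the chart at `x₀`. -/
noncomputable def christoffel (x₀ : M) (y v w : E) : E :=
  (chartMetric x₀ y).inverse (chartKoszul x₀ y v w)

variable {x₀ x : M} {y : E}

theorem chartMetric_apply (hy : y ∈ (extChartAt 𝓘(ℝ, E) x₀).target) (v w : E) :
    chartMetric x₀ y v w = ⟪frame x₀ v ((extChartAt 𝓘(ℝ, E) x₀).symm y),
      frame x₀ w ((extChartAt 𝓘(ℝ, E) x₀).symm y)⟫_ℝ := by
  rw [frame_eq_symmL (symm_mem_chart_source hy), frame_eq_symmL (symm_mem_chart_source hy)]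
  rfl

theorem inner_frame (hx : x ∈ (chartAt E x₀).source) (v w : E) :
    ⟪frame x₀ v x, frame x₀ w x⟫_ℝ = chartMetric x₀ (extChartAt 𝓘(ℝ, E) x₀ x) v w := by
  rw [chartMetric_apply (extChartAt_mem_target hx), extChartAt_symm_extChartAt hx]

theorem contDiffOn_chartMetric :
    ContDiffOn ℝ ∞ (chartMetric x₀) (extChartAt 𝓘(ℝ, E) x₀).target := by
  refine contDiffOn_dual fun v ↦ contDiffOn_dual fun w ↦ ?_
  refine ContDiffOn.congr (f := fun y ↦ ⟪frame x₀ v ((extChartAt 𝓘(ℝ, E) x₀).symm y),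
    frame x₀ w ((extChartAt 𝓘(ℝ, E) x₀).symm y)⟫_ℝ) ?_ fun y hy ↦ chartMetric_apply hy v w
  refine ContMDiffOn.contDiffOn fun y hy ↦ ContMDiffAt.contMDiffWithinAt ?_
  have hs := contMDiffAt_extChartAt_symm hy
  have hv (v : E) := (contMDiffAt_frame (symm_mem_chart_source hy) v).comp y hs
  exact ContMDiffAt.inner_bundle (F := E) (E := fun x : M ↦ TangentSpace 𝓘(ℝ, E) x)
    (IB := 𝓘(ℝ, E)) (hv v) (hv w)

theorem contDiffAt_chartMetric (hy : y ∈ (extChartAt 𝓘(ℝ, E) x₀).target) :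
    ContDiffAt ℝ ∞ (chartMetric x₀) y :=
  contDiffOn_chartMetric.contDiffAt ((isOpen_extChartAt_target x₀).mem_nhds hy)

theorem chartMetric_comm (hy : y ∈ (extChartAt 𝓘(ℝ, E) x₀).target) (v w : E) :
    chartMetric x₀ y v w = chartMetric x₀ y w v := by
  rw [chartMetric_apply hy, chartMetric_apply hy, real_inner_comm]

theorem isInvertible_chartMetric (hy : y ∈ (extChartAt 𝓘(ℝ, E) x₀).target) :
    (chartMetric x₀ y).IsInvertible := by
  have hinj : Function.Injective (chartMetric x₀ y).toLinearMap := by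
    rw [injective_iff_map_eq_zero]
    intro v hv
    have h1 : chartMetric x₀ y v v = 0 := DFunLike.congr_fun hv v
    rw [chartMetric_apply hy, inner_self_eq_zero] at h1
    rw [← coord_frame (symm_mem_chart_source hy) v, h1,
      coord_eq_mfderiv (symm_mem_chart_source hy), map_zero]
    rfl
  have hfr : Module.finrank ℝ E = Module.finrank ℝ (E →L[ℝ] ℝ) := by
    rw [← (LinearMap.toContinuousLinearMap (𝕜 := ℝ) (E := E) (F' := ℝ)).finrank_eq,
      Module.finrank_linearMap_self]
  exact ⟨(LinearEquiv.ofInjectiveOfFinrankEq _ hinj hfr).toContinuousLinearEquiv, rfl⟩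

theorem chartMetric_inverse (hy : y ∈ (extChartAt 𝓘(ℝ, E) x₀).target) (ℓ : E →L[ℝ] ℝ) :
    chartMetric x₀ y ((chartMetric x₀ y).inverse ℓ) = ℓ := by
  obtain ⟨e, he⟩ := isInvertible_chartMetric hy
  rw [← he, ContinuousLinearMap.inverse_equiv]
  exact e.apply_symm_apply ℓ

theorem contDiffOn_chartMetric_inverse :
    ContDiffOn ℝ ∞ (fun y ↦ (chartMetric x₀ y).inverse) (extChartAt 𝓘(ℝ, E) x₀).target := by
  intro y hy
  obtain ⟨e, he⟩ := isInvertible_chartMetric hy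
  have h : ContDiffAt ℝ ∞ ContinuousLinearMap.inverse (chartMetric x₀ y) := by
    have : CompleteSpace E := FiniteDimensional.complete ℝ E
    exact he ▸ contDiffAt_map_inverse e
  exact (h.comp y (contDiffAt_chartMetric hy)).contDiffWithinAt

theorem chartKoszul_apply (y v w z : E) : chartKoszul x₀ y v w z =
    (1 / 2 : ℝ) * (fderiv ℝ (chartMetric x₀) y v w z + fderiv ℝ (chartMetric x₀) y w v z -
      fderiv ℝ (chartMetric x₀) y z v w) := rfl

theorem chartMetric_christoffel (hy : y ∈ (extChartAt 𝓘(ℝ, E) x₀).target) (v w z : E) :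
    chartMetric x₀ y (christoffel x₀ y v w) z = chartKoszul x₀ y v w z := by
  rw [christoffel, chartMetric_inverse hy]

theorem mvfderiv_inner_frame (hx : x ∈ (chartAt E x₀).source) (u v w : E) :
    mvfderiv 𝓘(ℝ, E) (fun z ↦ ⟪frame x₀ v z, frame x₀ w z⟫_ℝ) x (frame x₀ u x) =
      fderiv ℝ (chartMetric x₀) (extChartAt 𝓘(ℝ, E) x₀ x) u v w := by
  have hy := extChartAt_mem_target hx
  rw [mvfderiv_frame hx (mdifferentiableAt_inner (mdifferentiableAt_frame hx v)
    (mdifferentiableAt_frame hx w))]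
  have h1 : ((fun z ↦ ⟪frame x₀ v z, frame x₀ w z⟫_ℝ) ∘ (extChartAt 𝓘(ℝ, E) x₀).symm) =ᶠ[nhds
      (extChartAt 𝓘(ℝ, E) x₀ x)] fun y ↦ chartMetric x₀ y v w := by
    filter_upwards [(isOpen_extChartAt_target x₀).mem_nhds hy] with y hy
      using (chartMetric_apply hy v w).symm
  have hd := (contDiffAt_chartMetric hy).differentiableAt (by simp)
  have h2 := (hd.hasFDerivAt.clm_apply (hasFDerivAt_const v _)).clm_apply (hasFDerivAt_const w _)
  rw [h1.fderiv_eq, h2.fderiv]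
  simp

theorem inner_covDeriv_frame (hx : x ∈ (chartAt E x₀).source) (u v w : E) :
    ⟪covDeriv 𝓘(ℝ, E) (frame x₀ v) x (frame x₀ u x), frame x₀ w x⟫_ℝ =
      chartKoszul x₀ (extChartAt 𝓘(ℝ, E) x₀ x) u v w := by
  rw [inner_covDeriv (mdifferentiableAt_frame hx u) (mdifferentiableAt_frame hx v)
    (mdifferentiableAt_frame hx w), koszul, chartKoszul_apply]
  simp only [mlieBracket_frame hx, inner_zero_right, mvfderiv_inner_frame hx]
  ring

set_option synthInstance.maxHeartbeats 200000 in
theorem contDiffOn_fderiv_chartMetric {F : Type*} [NormedAddCommGroup F] [NormedSpace ℝ F]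
    {s : Set F} {Y U V W : F → E} (hY : ContDiffOn ℝ ∞ Y s) (hU : ContDiffOn ℝ ∞ U s)
    (hV : ContDiffOn ℝ ∞ V s) (hW : ContDiffOn ℝ ∞ W s)
    (hs : Set.MapsTo Y s (extChartAt 𝓘(ℝ, E) x₀).target) :
    ContDiffOn ℝ ∞ (fun p ↦ fderiv ℝ (chartMetric x₀) (Y p) (U p) (V p) (W p)) s :=
  ((((contDiffOn_chartMetric.fderiv_of_isOpen (isOpen_extChartAt_target x₀)
    (by simp)).comp hY hs).clm_apply hU).clm_apply hV).clm_apply hW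

theorem contDiffOn_christoffel {F : Type*} [NormedAddCommGroup F] [NormedSpace ℝ F] {s : Set F}
    {Y V W : F → E} (hY : ContDiffOn ℝ ∞ Y s) (hV : ContDiffOn ℝ ∞ V s) (hW : ContDiffOn ℝ ∞ W s)
    (hs : Set.MapsTo Y s (extChartAt 𝓘(ℝ, E) x₀).target) :
    ContDiffOn ℝ ∞ (fun p ↦ christoffel x₀ (Y p) (V p) (W p)) s := by
  refine (contDiffOn_chartMetric_inverse.comp hY hs).clm_apply (contDiffOn_dual fun z ↦ ?_)
  simp only [chartKoszul_apply]
  exact contDiffOn_const.mul (((contDiffOn_fderiv_chartMetric hY hV hW contDiffOn_const hs).add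
    (contDiffOn_fderiv_chartMetric hY hW hV contDiffOn_const hs)).sub
    (contDiffOn_fderiv_chartMetric hY contDiffOn_const hV hW hs))

end ChartMetric

section Curves

variable {E : Type*} [NormedAddCommGroup E] [NormedSpace ℝ E] [FiniteDimensional ℝ E]
  {M : Type*} [TopologicalSpace M] [ChartedSpace E M] [IsManifold 𝓘(ℝ, E) ∞ M]

theorem mdifferentiableAt_base {γ : ℝ → M} {V : Π s, TangentSpace 𝓘(ℝ, E) (γ s)} {t : ℝ}
    (hV : MDifferentiableAt 𝓘(ℝ, ℝ) 𝓘(ℝ, E).tangent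
      (fun s ↦ (⟨γ s, V s⟩ : TangentBundle 𝓘(ℝ, E) M)) t) :
    MDifferentiableAt 𝓘(ℝ, ℝ) 𝓘(ℝ, E) γ t :=
  ((mdifferentiableAt_totalSpace _ _).1 hV).1

theorem differentiableAt_coord {x₀ : M} {γ : ℝ → M} {V : Π s, TangentSpace 𝓘(ℝ, E) (γ s)} {t : ℝ}
    (ht : γ t ∈ (chartAt E x₀).source)
    (hV : MDifferentiableAt 𝓘(ℝ, ℝ) 𝓘(ℝ, E).tangent
      (fun s ↦ (⟨γ s, V s⟩ : TangentBundle 𝓘(ℝ, E) M)) t) :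
    DifferentiableAt ℝ (fun s ↦ coord x₀ (V s)) t :=
  (((trivializationAt E (TangentSpace 𝓘(ℝ, E)) x₀).mdifferentiableAt_totalSpace_iff 𝓘(ℝ, E)
    (fun s ↦ (⟨γ s, V s⟩ : TangentBundle 𝓘(ℝ, E) M))
    (by simpa [Bundle.Trivialization.mem_source] using ht)).1 hV).2.differentiableAt

variable [Bundle.RiemannianBundle (fun x : M ↦ TangentSpace 𝓘(ℝ, E) x)]
  [IsContMDiffRiemannianBundle 𝓘(ℝ, E) ∞ E (fun x : M ↦ TangentSpace 𝓘(ℝ, E) x)]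

/-- Compatibility of the covariant derivative along a curve with the metric. -/
theorem hasDerivAt_inner_covDerivAlong {γ : ℝ → M} {V : Π s, TangentSpace 𝓘(ℝ, E) (γ s)} {t : ℝ}
    (hV : MDifferentiableAt 𝓘(ℝ, ℝ) 𝓘(ℝ, E).tangent
      (fun s ↦ (⟨γ s, V s⟩ : TangentBundle 𝓘(ℝ, E) M)) t)
    {Z : Π x : M, TangentSpace 𝓘(ℝ, E) x} (hZ : MDiffAt (T% Z) (γ t)) :
    HasDerivAt (fun s ↦ ⟪V s, Z (γ s)⟫_ℝ)
      (⟪covDerivAlong 𝓘(ℝ, E) γ V t, Z (γ t)⟫_ℝ +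
        ⟪V t, covDeriv 𝓘(ℝ, E) Z (γ t) (velocity 𝓘(ℝ, E) γ t)⟫_ℝ) t := by
  have hγ := mdifferentiableAt_base hV
  have hsrc : γ t ∈ (chartAt E (γ t)).source := mem_chart_source E (γ t)
  let c : ℝ → E := fun s ↦ coord (γ t) (V s)
  have hc : DifferentiableAt ℝ c t := differentiableAt_coord hsrc hV
  let b := Module.finBasis ℝ E
  let p (v : E) : ℝ → ℝ := fun s ↦ ⟪frame (γ t) v (γ s), Z (γ s)⟫_ℝ
  have hp (v : E) : HasDerivAt (p v) (⟪covDeriv 𝓘(ℝ, E) (frame (γ t) v) (γ t)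
      (velocity 𝓘(ℝ, E) γ t), Z (γ t)⟫_ℝ + ⟪frame (γ t) v (γ t),
      covDeriv 𝓘(ℝ, E) Z (γ t) (velocity 𝓘(ℝ, E) γ t)⟫_ℝ) t := by
    have h1 := mdifferentiableAt_frame hsrc v
    rw [← mvfderiv_inner h1 hZ]
    exact hasDerivAt_comp_curve (mdifferentiableAt_inner h1 hZ) hγ
  have hev : (fun s ↦ ⟪V s, Z (γ s)⟫_ℝ) =ᶠ[nhds t]
      fun s ↦ p (c t) s + ∑ i, b.equivFunL (c s - c t) i * p (b i) s := by
    filter_upwards [hγ.continuousAt.preimage_mem_nhds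
      ((chartAt E (γ t)).open_source.mem_nhds hsrc)] with s hs
    have hs : γ s ∈ (chartAt E (γ t)).source := hs
    have h1 : p (c s) s = p (c t) s + p (c s - c t) s := by
      simp only [p]
      rw [← inner_add_left, ← frame_add hs, add_sub_cancel]
    have h2 : p (c s - c t) s = ∑ i, b.equivFunL (c s - c t) i * p (b i) s := by
      have h3 : p (c s - c t) s = p (∑ i, b.equivFunL (c s - c t) i • b i) s := by
        congr 1
        exact (b.sum_equivFun (c s - c t)).symm
      rw [h3]
      simp only [p, frame_eq_symmL hs, map_sum, map_smul, sum_inner, inner_smul_left,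
        RCLike.conj_to_real]
    rw [← h2, ← h1]
    simp only [p, c, frame_coord hs]
  refine HasDerivAt.congr_of_eventuallyEq ?_ hev
  have hd (i) : HasDerivAt (fun s ↦ b.equivFunL (c s - c t) i * p (b i) s)
      (b.equivFunL (deriv c t) i * p (b i) t) t := by
    have h1 : HasDerivAt (fun s ↦ b.equivFunL (c s - c t) i) (b.equivFunL (deriv c t) i) t :=
      hasDerivAt_pi.1 (b.equivFunL.toContinuousLinearMap.hasFDerivAt.comp_hasDerivAt t
        (hc.hasDerivAt.sub_const (c t))) i
    have h2 := h1.mul (hp (b i))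
    simpa using! h2
  refine ((hp (c t)).add (HasDerivAt.fun_sum fun i _ ↦ hd i)).congr_deriv ?_
  have h4 : ∑ i, b.equivFunL (deriv c t) i * p (b i) t =
      ⟪frame (γ t) (deriv c t) (γ t), Z (γ t)⟫_ℝ := by
    conv_rhs => rw [← b.sum_equivFun (deriv c t)]
    simp only [p, frame_eq_symmL hsrc, map_sum, map_smul, sum_inner, inner_smul_left,
      RCLike.conj_to_real]
    rfl
  have h5 : covDerivAlong 𝓘(ℝ, E) γ V t = frame (γ t) (deriv c t) (γ t) +
      covDeriv 𝓘(ℝ, E) (frame (γ t) (c t)) (γ t) (velocity 𝓘(ℝ, E) γ t) := rfl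
  have h6 : frame (γ t) (c t) (γ t) = V t := frame_coord hsrc _
  rw [h4, h5, h6, inner_add_left]
  ring

set_option synthInstance.maxHeartbeats 200000 in
/-- The covariant derivative along a curve in an arbitrary chart. -/
theorem inner_covDerivAlong_frame {x₀ : M} {γ : ℝ → M} {V : Π s, TangentSpace 𝓘(ℝ, E) (γ s)}
    {t : ℝ} (ht : γ t ∈ (chartAt E x₀).source)
    (hV : MDifferentiableAt 𝓘(ℝ, ℝ) 𝓘(ℝ, E).tangent
      (fun s ↦ (⟨γ s, V s⟩ : TangentBundle 𝓘(ℝ, E) M)) t) (z : E) :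
    ⟪covDerivAlong 𝓘(ℝ, E) γ V t, frame x₀ z (γ t)⟫_ℝ =
      chartMetric x₀ (extChartAt 𝓘(ℝ, E) x₀ (γ t)) (deriv (fun s ↦ coord x₀ (V s)) t) z +
      chartKoszul x₀ (extChartAt 𝓘(ℝ, E) x₀ (γ t)) (deriv (extChartAt 𝓘(ℝ, E) x₀ ∘ γ) t)
        (coord x₀ (V t)) z := by
  have hγ := mdifferentiableAt_base hV
  have hy := extChartAt_mem_target ht
  have hc := differentiableAt_coord ht hV
  have h1 := hasDerivAt_inner_covDerivAlong hV (mdifferentiableAt_frame ht z)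
  have hγ' : HasDerivAt (extChartAt 𝓘(ℝ, E) x₀ ∘ γ) (deriv (extChartAt 𝓘(ℝ, E) x₀ ∘ γ) t) t :=
    ((mdifferentiableAt_extChartAt (I := 𝓘(ℝ, E)) ht).comp t hγ).differentiableAt.hasDerivAt
  have hG := ((contDiffAt_chartMetric hy).differentiableAt (by simp)).hasFDerivAt.comp_hasDerivAt t
    hγ'
  have h2 := (hG.clm_apply hc.hasDerivAt).clm_apply (hasDerivAt_const t z)
  have hev : (fun s ↦ ⟪V s, frame x₀ z (γ s)⟫_ℝ) =ᶠ[nhds t]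
      fun s ↦ (chartMetric x₀ ∘ extChartAt 𝓘(ℝ, E) x₀ ∘ γ) s (coord x₀ (V s)) z := by
    filter_upwards [hγ.continuousAt.preimage_mem_nhds
      ((chartAt E x₀).open_source.mem_nhds ht)] with s hs
    have h := inner_frame hs (coord x₀ (V s)) z
    rwa [frame_coord hs] at h
  have h3 := h1.unique (h2.congr_of_eventuallyEq hev)
  have h4 : ⟪V t, covDeriv 𝓘(ℝ, E) (frame x₀ z) (γ t) (velocity 𝓘(ℝ, E) γ t)⟫_ℝ =
      chartKoszul x₀ (extChartAt 𝓘(ℝ, E) x₀ (γ t)) (deriv (extChartAt 𝓘(ℝ, E) x₀ ∘ γ) t) z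
        (coord x₀ (V t)) := by
    rw [← inner_covDeriv_frame ht, ← velocity_eq_frame ht hγ, frame_coord ht, real_inner_comm]
  rw [h4] at h3
  have hsymm (u v w : E) : fderiv ℝ (chartMetric x₀) (extChartAt 𝓘(ℝ, E) x₀ (γ t)) u v w =
      fderiv ℝ (chartMetric x₀) (extChartAt 𝓘(ℝ, E) x₀ (γ t)) u w v := by
    rw [← mvfderiv_inner_frame ht, ← mvfderiv_inner_frame ht]
    simp only [real_inner_comm]
  simp only [chartKoszul_apply, Function.comp_apply, add_zero, map_zero,
    add_apply] at h3 ⊢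
  linarith [hsymm (deriv (extChartAt 𝓘(ℝ, E) x₀ ∘ γ) t) z (coord x₀ (V t))]

end Curves

section Gradient

variable {E : Type*} [NormedAddCommGroup E] [NormedSpace ℝ E] [FiniteDimensional ℝ E]
  {M : Type*} [TopologicalSpace M] [ChartedSpace E M] [IsManifold 𝓘(ℝ, E) ∞ M]
  [Bundle.RiemannianBundle (fun x : M ↦ TangentSpace 𝓘(ℝ, E) x)]
  {f a b : M → ℝ} {x : M}

theorem inner_grad (f : M → ℝ) (x : M) (v : TangentSpace 𝓘(ℝ, E) x) :
    ⟪grad 𝓘(ℝ, E) f x, v⟫_ℝ = mvfderiv 𝓘(ℝ, E) f x v := by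
  rw [grad, InnerProductSpace.toDual_symm_apply]

theorem eventually_contMDiffAt (hf : ContMDiffAt 𝓘(ℝ, E) 𝓘(ℝ, ℝ) ∞ f x) :
    ∀ᶠ y in nhds x, MDifferentiableAt 𝓘(ℝ, E) 𝓘(ℝ, ℝ) f y := by
  have h1 : ContMDiffAt 𝓘(ℝ, E) 𝓘(ℝ, ℝ) 1 f x := hf.of_le (by exact_mod_cast le_top)
  filter_upwards [(contMDiffAt_iff_contMDiffAt_nhds (by simp)).1 h1] with y hy using hy.mdifferentiableAt one_ne_zero

theorem contDiffAt_comp_extChartAt_symm (hf : ContMDiffAt 𝓘(ℝ, E) 𝓘(ℝ, ℝ) ∞ f x) :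
    ContDiffAt ℝ ∞ (f ∘ (extChartAt 𝓘(ℝ, E) x).symm) (extChartAt 𝓘(ℝ, E) x x) := by
  have hx := mem_chart_source E x
  refine ContMDiffAt.contDiffAt (ContMDiffAt.comp _ ?_
    (contMDiffAt_extChartAt_symm (extChartAt_mem_target hx)))
  rwa [extChartAt_symm_extChartAt hx]

variable [IsContMDiffRiemannianBundle 𝓘(ℝ, E) ∞ E (fun x : M ↦ TangentSpace 𝓘(ℝ, E) x)]

theorem contMDiffAt_grad (hf : ContMDiffAt 𝓘(ℝ, E) 𝓘(ℝ, ℝ) ∞ f x) :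
    ContMDiffAt 𝓘(ℝ, E) 𝓘(ℝ, E).tangent ∞ (T% (grad 𝓘(ℝ, E) f)) x := by
  rw [Bundle.contMDiffAt_section]
  have hx := mem_chart_source E x
  have hy := extChartAt_mem_target hx
  have hF := contDiffAt_comp_extChartAt_symm hf
  have h1 : ContDiffAt ℝ ∞ (fun y ↦ (chartMetric x y).inverse
      (fderiv ℝ (f ∘ (extChartAt 𝓘(ℝ, E) x).symm) y)) (extChartAt 𝓘(ℝ, E) x x) :=
    (contDiffOn_chartMetric_inverse.contDiffAt ((isOpen_extChartAt_target x).mem_nhds hy)).clm_apply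
      (hF.fderiv_right (by simp))
  refine (h1.contMDiffAt.comp x (contMDiffAt_extChartAt (I := 𝓘(ℝ, E)))).congr_of_eventuallyEq ?_
  filter_upwards [(chartAt E x).open_source.mem_nhds hx, eventually_contMDiffAt hf] with z hz hfz
  have h2 : chartMetric x (extChartAt 𝓘(ℝ, E) x z) (coord x (grad 𝓘(ℝ, E) f z)) =
      fderiv ℝ (f ∘ (extChartAt 𝓘(ℝ, E) x).symm) (extChartAt 𝓘(ℝ, E) x z) := by
    ext v
    rw [← inner_frame hz, frame_coord hz, inner_grad, mvfderiv_frame hz hfz]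
  obtain ⟨e, he⟩ := isInvertible_chartMetric (extChartAt_mem_target hz)
  rw [Function.comp_apply, ← h2, ← he, ContinuousLinearMap.inverse_equiv]
  exact (e.symm_apply_apply _).symm

theorem mdifferentiableAt_grad (hf : ContMDiffAt 𝓘(ℝ, E) 𝓘(ℝ, ℝ) ∞ f x) :
    MDiffAt (T% (grad 𝓘(ℝ, E) f)) x :=
  (contMDiffAt_grad hf).mdifferentiableAt (by simp)

theorem covDeriv_frame_comm {x₀ : M} (hx : x ∈ (chartAt E x₀).source) (v w : E) :
    covDeriv 𝓘(ℝ, E) (frame x₀ v) x (frame x₀ w x) =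
      covDeriv 𝓘(ℝ, E) (frame x₀ w) x (frame x₀ v x) := by
  refine ext_inner_right ℝ fun z ↦ ?_
  have hz := mdifferentiableAt_extend_tangent z
  have hv := mdifferentiableAt_frame hx v
  have hw := mdifferentiableAt_frame hx w
  have h1 := inner_covDeriv hw hv hz
  have h2 := inner_covDeriv hv hw hz
  have h3 := koszul_sub_koszul_swap (frame x₀ v) (frame x₀ w) (extend E z) x
  rw [mlieBracket_frame hx, inner_zero_left] at h3
  rw [extend_apply_self] at h1 h2
  rw [h1, h2]
  linarith

/-- The Hessian is symmetric. -/
theorem inner_covDeriv_grad_comm (hf : ContMDiffAt 𝓘(ℝ, E) 𝓘(ℝ, ℝ) ∞ f x)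
    (v w : TangentSpace 𝓘(ℝ, E) x) :
    ⟪covDeriv 𝓘(ℝ, E) (grad 𝓘(ℝ, E) f) x v, w⟫_ℝ =
      ⟪covDeriv 𝓘(ℝ, E) (grad 𝓘(ℝ, E) f) x w, v⟫_ℝ := by
  have hx := mem_chart_source E x
  have hF := contDiffAt_comp_extChartAt_symm hf
  have key (v w : E) : ⟪covDeriv 𝓘(ℝ, E) (grad 𝓘(ℝ, E) f) x (frame x v x), frame x w x⟫_ℝ =
      fderiv ℝ (fderiv ℝ (f ∘ (extChartAt 𝓘(ℝ, E) x).symm)) (extChartAt 𝓘(ℝ, E) x x) v w -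
        ⟪grad 𝓘(ℝ, E) f x, covDeriv 𝓘(ℝ, E) (frame x w) x (frame x v x)⟫_ℝ := by
    have hg := mdifferentiableAt_grad hf
    have hw := mdifferentiableAt_frame hx w
    rw [eq_sub_iff_add_eq, ← mvfderiv_inner hg hw, mvfderiv_frame hx (mdifferentiableAt_inner hg hw)]
    have hev : ((fun y ↦ ⟪grad 𝓘(ℝ, E) f y, frame x w y⟫_ℝ) ∘ (extChartAt 𝓘(ℝ, E) x).symm) =ᶠ[nhds
        (extChartAt 𝓘(ℝ, E) x x)] fun y ↦ fderiv ℝ (f ∘ (extChartAt 𝓘(ℝ, E) x).symm) y w := by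
      have h1 := (contMDiffAt_extChartAt_symm (extChartAt_mem_target hx)).continuousAt.eventually
        ((extChartAt_symm_extChartAt hx).symm ▸ eventually_contMDiffAt hf)
      filter_upwards [h1, (isOpen_extChartAt_target x).mem_nhds (extChartAt_mem_target hx)]
        with y hfy hy
      rw [Function.comp_apply, inner_grad, mvfderiv_frame (symm_mem_chart_source hy) hfy,
        (extChartAt 𝓘(ℝ, E) x).right_inv hy]
    have h2 : DifferentiableAt ℝ (fderiv ℝ (f ∘ (extChartAt 𝓘(ℝ, E) x).symm))
        (extChartAt 𝓘(ℝ, E) x x) :=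
      (hF.fderiv_right (m := ∞) (by simp)).differentiableAt (by simp)
    rw [hev.fderiv_eq, (h2.hasFDerivAt.clm_apply (hasFDerivAt_const w _)).fderiv]
    simp
  have hs : IsSymmSndFDerivAt ℝ (f ∘ (extChartAt 𝓘(ℝ, E) x).symm) (extChartAt 𝓘(ℝ, E) x x) :=
    hF.isSymmSndFDerivAt minSmoothness_two_le_infty
  have h1 := key (coord x v) (coord x w)
  have h2 := key (coord x w) (coord x v)
  rw [frame_coord hx, frame_coord hx] at h1 h2
  rw [h1, h2, hs.eq]
  have h3 := covDeriv_frame_comm hx (coord x w) (coord x v)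
  rw [frame_coord hx, frame_coord hx] at h3
  rw [h3]

/-- The Hessian in terms of the carré du champ. -/
theorem two_mul_inner_covDeriv_grad (hf : ContMDiffAt 𝓘(ℝ, E) 𝓘(ℝ, ℝ) ∞ f x)
    (ha : ContMDiffAt 𝓘(ℝ, E) 𝓘(ℝ, ℝ) ∞ a x) (hb : ContMDiffAt 𝓘(ℝ, E) 𝓘(ℝ, ℝ) ∞ b x) :
    2 * ⟪covDeriv 𝓘(ℝ, E) (grad 𝓘(ℝ, E) f) x (grad 𝓘(ℝ, E) a x), grad 𝓘(ℝ, E) b x⟫_ℝ =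
      mvfderiv 𝓘(ℝ, E) (fun y ↦ ⟪grad 𝓘(ℝ, E) f y, grad 𝓘(ℝ, E) b y⟫_ℝ) x (grad 𝓘(ℝ, E) a x) +
      mvfderiv 𝓘(ℝ, E) (fun y ↦ ⟪grad 𝓘(ℝ, E) f y, grad 𝓘(ℝ, E) a y⟫_ℝ) x (grad 𝓘(ℝ, E) b x) -
      mvfderiv 𝓘(ℝ, E) (fun y ↦ ⟪grad 𝓘(ℝ, E) a y, grad 𝓘(ℝ, E) b y⟫_ℝ) x (grad 𝓘(ℝ, E) f x) := by
  have hf' := mdifferentiableAt_grad hf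
  have ha' := mdifferentiableAt_grad ha
  have hb' := mdifferentiableAt_grad hb
  rw [mvfderiv_inner hf' hb', mvfderiv_inner hf' ha', mvfderiv_inner ha' hb']
  have h1 := inner_covDeriv_grad_comm hf (grad 𝓘(ℝ, E) a x) (grad 𝓘(ℝ, E) b x)
  have h2 := inner_covDeriv_grad_comm ha (grad 𝓘(ℝ, E) b x) (grad 𝓘(ℝ, E) f x)
  have h3 := inner_covDeriv_grad_comm hb (grad 𝓘(ℝ, E) a x) (grad 𝓘(ℝ, E) f x)
  rw [real_inner_comm] at h2 h3
  rw [real_inner_comm _ (grad 𝓘(ℝ, E) a x)]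
  linarith

/-- Every tangent vector is the gradient of a locally smooth function. -/
theorem exists_grad_eq (w : TangentSpace 𝓘(ℝ, E) x) :
    ∃ h : M → ℝ, ContMDiffAt 𝓘(ℝ, E) 𝓘(ℝ, ℝ) ∞ h x ∧ grad 𝓘(ℝ, E) h x = w := by
  have hx := mem_chart_source E x
  let ℓ : E →L[ℝ] ℝ := chartMetric x (extChartAt 𝓘(ℝ, E) x x) (coord x w)
  have hh : ContMDiffAt 𝓘(ℝ, E) 𝓘(ℝ, ℝ) ∞ (ℓ ∘ extChartAt 𝓘(ℝ, E) x) x :=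
    ℓ.contDiff.contDiffAt.contMDiffAt.comp x contMDiffAt_extChartAt
  refine ⟨_, hh, ext_inner_right ℝ fun v ↦ ?_⟩
  have hev : ((ℓ ∘ extChartAt 𝓘(ℝ, E) x) ∘ (extChartAt 𝓘(ℝ, E) x).symm) =ᶠ[nhds
      (extChartAt 𝓘(ℝ, E) x x)] ℓ := by
    filter_upwards [(isOpen_extChartAt_target x).mem_nhds (extChartAt_mem_target hx)] with y hy
    rw [Function.comp_apply, Function.comp_apply, (extChartAt 𝓘(ℝ, E) x).right_inv hy]
  rw [inner_grad, ← frame_coord hx v, mvfderiv_frame hx (hh.mdifferentiableAt (by simp)),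
    hev.fderiv_eq, ContinuousLinearMap.fderiv]
  simp only [ℓ]
  rw [← inner_frame hx, frame_coord hx]

end Gradient

/-- Local existence and smoothness of integral curves of a smooth vector field. -/
theorem exists_smooth_integralCurve {W : Type*} [NormedAddCommGroup W] [NormedSpace ℝ W]
    [CompleteSpace W] {f : W → W} {s : Set W} (hs : IsOpen s) (hf : ContDiffOn ℝ ∞ f s) {p : W}
    (hp : p ∈ s) : ∃ α : ℝ → W, ∃ ε > 0, α 0 = p ∧ ContDiffOn ℝ ∞ α (Set.Ioo (-ε) ε) ∧
      ∀ t ∈ Set.Ioo (-ε) ε, α t ∈ s ∧ HasDerivAt α (f (α t)) t := by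
  have h1 : ContDiffAt ℝ 1 f p :=
    (hf.contDiffAt (hs.mem_nhds hp)).of_le (by exact_mod_cast le_top)
  obtain ⟨α, hα0, ε, hε, hα⟩ :=
    h1.exists_forall_mem_closedBall_exists_eq_forall_mem_Ioo_hasDerivAt₀ 0
  simp only [zero_sub, zero_add] at hα
  have hcont : ContinuousAt α 0 := (hα 0 ⟨by linarith, hε⟩).continuousAt
  obtain ⟨δ, hδ, hδs⟩ := Metric.eventually_nhds_iff_ball.1
    (hcont.eventually (hα0.symm ▸ hs.mem_nhds hp))
  simp only [Real.ball_eq_Ioo, zero_sub, zero_add] at hδs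
  set η := min ε δ / 2 with hη
  have hηpos : 0 < η := by positivity
  have hηε : η < ε := by have := min_le_left ε δ; linarith [lt_min hε hδ]
  have hηδ : η < δ := by have := min_le_right ε δ; linarith [lt_min hε hδ]
  have hmaps : Set.MapsTo α (Set.Icc (-η) η) s := fun t ht ↦
    hδs t ⟨by linarith [ht.1], by linarith [ht.2]⟩
  have hd (t) (ht : t ∈ Set.Icc (-η) η) : HasDerivAt α (f (α t)) t :=
    hα t ⟨by linarith [ht.1], by linarith [ht.2]⟩
  have hsm := ODE.contDiffOn_enat_Icc_of_hasDerivWithinAt (n := ⊤) (f := fun _ ↦ f) (u := s)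
    (hf.comp contDiffOn_snd fun q hq ↦ hq.2) (fun t ht ↦ (hd t ht).hasDerivWithinAt) hmaps
  exact ⟨α, η, hηpos, hα0, hsm.mono Set.Ioo_subset_Icc_self, fun t ht ↦
    ⟨hmaps (Set.Ioo_subset_Icc_self ht), hd t (Set.Ioo_subset_Icc_self ht)⟩⟩

theorem eq_of_hasDerivAt_zero {V : Type*} [NormedAddCommGroup V] [NormedSpace ℝ V] {h : ℝ → V}
    {ε : ℝ} (hε : 0 < ε) (hd : ∀ t ∈ Set.Ioo (-ε) ε, HasDerivAt h 0 t) {t : ℝ}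
    (ht : t ∈ Set.Ioo (-ε) ε) : h t = h 0 :=
  isOpen_Ioo.is_const_of_deriv_eq_zero isPreconnected_Ioo
    (fun s hs ↦ (hd s hs).differentiableAt.differentiableWithinAt) (fun s hs ↦ (hd s hs).deriv) ht
    ⟨by linarith, hε⟩

section ChartCurve

variable {E : Type*} [NormedAddCommGroup E] [NormedSpace ℝ E] [FiniteDimensional ℝ E]
  {M : Type*} [TopologicalSpace M] [ChartedSpace E M] [IsManifold 𝓘(ℝ, E) ∞ M]
  {x₀ : M} {c w : ℝ → E} {J : Set ℝ}

theorem contMDiffOn_chart_curve (hc : ContDiffOn ℝ ∞ c J)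
    (hJc : Set.MapsTo c J (extChartAt 𝓘(ℝ, E) x₀).target) :
    ContMDiffOn 𝓘(ℝ, ℝ) 𝓘(ℝ, E) ∞ (fun t ↦ (extChartAt 𝓘(ℝ, E) x₀).symm (c t)) J :=
  (contMDiffOn_extChartAt_symm x₀).comp hc.contMDiffOn hJc

theorem contMDiffOn_frame_curve (hc : ContDiffOn ℝ ∞ c J)
    (hJc : Set.MapsTo c J (extChartAt 𝓘(ℝ, E) x₀).target) (hw : ContDiffOn ℝ ∞ w J) :
    ContMDiffOn 𝓘(ℝ, ℝ) 𝓘(ℝ, E).tangent ∞ (fun t ↦ (⟨(extChartAt 𝓘(ℝ, E) x₀).symm (c t),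
      frame x₀ (w t) ((extChartAt 𝓘(ℝ, E) x₀).symm (c t))⟩ : TangentBundle 𝓘(ℝ, E) M)) J := by
  refine ((trivializationAt E (TangentSpace 𝓘(ℝ, E)) x₀).contMDiffOn_iff (IB := 𝓘(ℝ, E))
    fun t ht ↦ ?_).2 ⟨contMDiffOn_chart_curve hc hJc, hw.contMDiffOn.congr fun t ht ↦ ?_⟩
  · simpa [Bundle.Trivialization.mem_source] using symm_mem_chart_source (hJc ht)
  · exact coord_frame (symm_mem_chart_source (hJc ht)) (w t)

theorem velocity_chart_curve {t : ℝ} {v : E} (hct : HasDerivAt c v t)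
    (ht : c t ∈ (extChartAt 𝓘(ℝ, E) x₀).target) :
    velocity 𝓘(ℝ, E) (fun t ↦ (extChartAt 𝓘(ℝ, E) x₀).symm (c t)) t =
      frame x₀ v ((extChartAt 𝓘(ℝ, E) x₀).symm (c t)) := by
  have hγ : MDifferentiableAt 𝓘(ℝ, ℝ) 𝓘(ℝ, E) (fun t ↦ (extChartAt 𝓘(ℝ, E) x₀).symm (c t)) t :=
    ((contMDiffAt_extChartAt_symm ht).mdifferentiableAt (by simp)).comp t
      hct.differentiableAt.mdifferentiableAt
  refine (velocity_eq_frame (γ := fun t ↦ (extChartAt 𝓘(ℝ, E) x₀).symm (c t))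
    (symm_mem_chart_source ht) hγ).trans ?_
  congr 1
  refine (hct.congr_of_eventuallyEq ?_).deriv
  filter_upwards [hct.continuousAt.preimage_mem_nhds ((isOpen_extChartAt_target x₀).mem_nhds ht)]
    with s hs using (extChartAt 𝓘(ℝ, E) x₀).right_inv hs

variable [Bundle.RiemannianBundle (fun x : M ↦ TangentSpace 𝓘(ℝ, E) x)]
  [IsContMDiffRiemannianBundle 𝓘(ℝ, E) ∞ E (fun x : M ↦ TangentSpace 𝓘(ℝ, E) x)]

/-- The covariant derivative of a vector field along a curve, for a curve of tangent vectors that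
is given in the coordinates of a chart. -/
theorem inner_covDerivAlong_chart_curve {γ : ℝ → M} {V : Π s, TangentSpace 𝓘(ℝ, E) (γ s)} {t : ℝ}
    {v w' : E} (hc : HasDerivAt c v t) (hw : HasDerivAt w w' t)
    (ht : c t ∈ (extChartAt 𝓘(ℝ, E) x₀).target)
    (hV : ∀ᶠ s in nhds t, (⟨γ s, V s⟩ : TangentBundle 𝓘(ℝ, E) M) =
      ⟨(extChartAt 𝓘(ℝ, E) x₀).symm (c s), frame x₀ (w s) ((extChartAt 𝓘(ℝ, E) x₀).symm (c s))⟩)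
    (hVt : MDifferentiableAt 𝓘(ℝ, ℝ) 𝓘(ℝ, E).tangent
      (fun s ↦ (⟨γ s, V s⟩ : TangentBundle 𝓘(ℝ, E) M)) t) (z : E) :
    ⟪covDerivAlong 𝓘(ℝ, E) γ V t, frame x₀ z (γ t)⟫_ℝ =
      chartMetric x₀ (c t) (w' + christoffel x₀ (c t) v (w t)) z := by
  have hcev := hc.continuousAt.preimage_mem_nhds ((isOpen_extChartAt_target x₀).mem_nhds ht)
  have h1 : (extChartAt 𝓘(ℝ, E) x₀ ∘ γ) =ᶠ[nhds t] c := by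
    filter_upwards [hV, hcev] with s hs hcs
    have h : γ s = (extChartAt 𝓘(ℝ, E) x₀).symm (c s) := congrArg Bundle.TotalSpace.proj hs
    rw [Function.comp_apply, h, (extChartAt 𝓘(ℝ, E) x₀).right_inv hcs]
  have h2 : (fun s ↦ coord x₀ (V s)) =ᶠ[nhds t] w := by
    filter_upwards [hV, hcev] with s hs hcs
    have h : coord x₀ (V s) =
        coord x₀ (frame x₀ (w s) ((extChartAt 𝓘(ℝ, E) x₀).symm (c s))) :=
      congrArg (fun q : TangentBundle 𝓘(ℝ, E) M ↦
        (trivializationAt E (TangentSpace 𝓘(ℝ, E)) x₀ q).2) hs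
    rw [h, coord_frame (symm_mem_chart_source hcs)]
  have hγt : γ t ∈ (chartAt E x₀).source := by
    have h : γ t = (extChartAt 𝓘(ℝ, E) x₀).symm (c t) :=
      congrArg Bundle.TotalSpace.proj hV.self_of_nhds
    rw [h]
    exact symm_mem_chart_source ht
  have h3 := h1.self_of_nhds
  have h4 : coord x₀ (V t) = w t := h2.self_of_nhds
  rw [Function.comp_apply] at h3
  rw [inner_covDerivAlong_frame hγt hVt, h1.deriv_eq, h2.deriv_eq, hc.deriv, hw.deriv, h3,
    h4, map_add, add_apply, chartMetric_christoffel ht]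

end ChartCurve

section Lift

variable {E : Type*} [NormedAddCommGroup E] [NormedSpace ℝ E] [FiniteDimensional ℝ E]
  {M : Type*} [TopologicalSpace M] [ChartedSpace E M] [IsManifold 𝓘(ℝ, E) ∞ M]
  [Bundle.RiemannianBundle (fun x : M ↦ TangentSpace 𝓘(ℝ, E) x)]
  {E' : Type*} [NormedAddCommGroup E'] [NormedSpace ℝ E'] [FiniteDimensional ℝ E']
  {N : Type*} [TopologicalSpace N] [ChartedSpace E' N] [IsManifold 𝓘(ℝ, E') ∞ N]
  [Bundle.RiemannianBundle (fun x : N ↦ TangentSpace 𝓘(ℝ, E') x)]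
  {pr : N → M}

/-- The adjoint of the differential of a map; for a Riemannian submersion this is the horizontal
lift. -/
noncomputable def horizontalLift (pr : N → M) (u : N) :
    TangentSpace 𝓘(ℝ, E) (pr u) →ₗ[ℝ] TangentSpace 𝓘(ℝ, E') u :=
  LinearMap.adjoint (mfderiv 𝓘(ℝ, E') 𝓘(ℝ, E) pr u).toLinearMap

theorem inner_horizontalLift (u : N) (w : TangentSpace 𝓘(ℝ, E) (pr u))
    (v : TangentSpace 𝓘(ℝ, E') u) :
    ⟪horizontalLift pr u w, v⟫_ℝ = ⟪w, mfderiv 𝓘(ℝ, E') 𝓘(ℝ, E) pr u v⟫_ℝ :=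
  LinearMap.adjoint_inner_left _ _ _

theorem horizontalLift_mem (u : N) (w : TangentSpace 𝓘(ℝ, E) (pr u)) :
    horizontalLift pr u w ∈ horizontalSpace 𝓘(ℝ, E) 𝓘(ℝ, E') pr u := by
  refine (Submodule.mem_orthogonal' _ _).2 fun v hv ↦ ?_
  have hv' : mfderiv 𝓘(ℝ, E') 𝓘(ℝ, E) pr u v = 0 := hv
  rw [inner_horizontalLift, hv', inner_zero_right]

theorem mfderiv_horizontalLift (hpr : IsRiemannianSubmersion 𝓘(ℝ, E) 𝓘(ℝ, E') pr) (u : N)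
    (w : TangentSpace 𝓘(ℝ, E) (pr u)) :
    mfderiv 𝓘(ℝ, E') 𝓘(ℝ, E) pr u (horizontalLift pr u w) = w := by
  refine ext_inner_right ℝ fun z ↦ ?_
  obtain ⟨v, hv, rfl⟩ := (hpr.bijOn u).surjOn (Set.mem_univ z)
  rw [hpr.isometry u _ (horizontalLift_mem u w) v hv, inner_horizontalLift]

theorem grad_comp_eq_horizontalLift {f : M → ℝ} {u : N}
    (hpr : MDifferentiableAt 𝓘(ℝ, E') 𝓘(ℝ, E) pr u)
    (hf : MDifferentiableAt 𝓘(ℝ, E) 𝓘(ℝ, ℝ) f (pr u)) :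
    grad 𝓘(ℝ, E') (f ∘ pr) u = horizontalLift pr u (grad 𝓘(ℝ, E) f (pr u)) := by
  refine ext_inner_right ℝ fun v ↦ ?_
  rw [inner_horizontalLift, inner_grad, inner_grad, mvfderiv_comp_apply u hf hpr]

theorem horizontalGrad_comp (hpr : ContMDiff 𝓘(ℝ, E') 𝓘(ℝ, E) ∞ pr) {f : M → ℝ}
    (hf : ContMDiff 𝓘(ℝ, E) 𝓘(ℝ, ℝ) ∞ f) :
    horizontalGrad 𝓘(ℝ, E) 𝓘(ℝ, E') pr (f ∘ pr) = grad 𝓘(ℝ, E') (f ∘ pr) := by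
  funext u
  rw [horizontalGrad, grad_comp_eq_horizontalLift (hpr.mdifferentiableAt (by simp))
    (hf.mdifferentiableAt (by simp)), Submodule.starProjection_eq_self_iff]
  exact horizontalLift_mem u _

variable [IsContMDiffRiemannianBundle 𝓘(ℝ, E) ∞ E (fun x : M ↦ TangentSpace 𝓘(ℝ, E) x)]
  [IsContMDiffRiemannianBundle 𝓘(ℝ, E') ∞ E' (fun x : N ↦ TangentSpace 𝓘(ℝ, E') x)]

/-- The carré du champ of functions that are constant on the fibers. -/
theorem mvfderiv_inner_grad_comp (hpr : IsRiemannianSubmersion 𝓘(ℝ, E) 𝓘(ℝ, E') pr) {u : N}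
    {a b c : M → ℝ} (ha : ContMDiffAt 𝓘(ℝ, E) 𝓘(ℝ, ℝ) ∞ a (pr u))
    (hb : ContMDiffAt 𝓘(ℝ, E) 𝓘(ℝ, ℝ) ∞ b (pr u)) (hc : ContMDiffAt 𝓘(ℝ, E) 𝓘(ℝ, ℝ) ∞ c (pr u)) :
    mvfderiv 𝓘(ℝ, E') (fun v ↦ ⟪grad 𝓘(ℝ, E') (a ∘ pr) v, grad 𝓘(ℝ, E') (b ∘ pr) v⟫_ℝ) u
        (grad 𝓘(ℝ, E') (c ∘ pr) u) =
      mvfderiv 𝓘(ℝ, E) (fun x ↦ ⟪grad 𝓘(ℝ, E) a x, grad 𝓘(ℝ, E) b x⟫_ℝ) (pr u)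
        (grad 𝓘(ℝ, E) c (pr u)) := by
  have hd (v : N) := hpr.contMDiff.mdifferentiableAt (x := v) (by simp)
  have hev : (fun v ↦ ⟪grad 𝓘(ℝ, E') (a ∘ pr) v, grad 𝓘(ℝ, E') (b ∘ pr) v⟫_ℝ) =ᶠ[nhds u]
      (fun x ↦ ⟪grad 𝓘(ℝ, E) a x, grad 𝓘(ℝ, E) b x⟫_ℝ) ∘ pr := by
    filter_upwards [hpr.contMDiff.continuous.continuousAt.eventually (eventually_contMDiffAt ha),
      hpr.contMDiff.continuous.continuousAt.eventually (eventually_contMDiffAt hb)] with v hav hbv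
    rw [grad_comp_eq_horizontalLift (hd v) hav, grad_comp_eq_horizontalLift (hd v) hbv,
      inner_horizontalLift, mfderiv_horizontalLift hpr, Function.comp_apply]
  have hgg := mdifferentiableAt_inner (mdifferentiableAt_grad ha) (mdifferentiableAt_grad hb)
  have h1 : mvfderiv 𝓘(ℝ, E')
      (fun v ↦ ⟪grad 𝓘(ℝ, E') (a ∘ pr) v, grad 𝓘(ℝ, E') (b ∘ pr) v⟫_ℝ) u =
      mvfderiv 𝓘(ℝ, E') ((fun x ↦ ⟪grad 𝓘(ℝ, E) a x, grad 𝓘(ℝ, E) b x⟫_ℝ) ∘ pr) u := by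
    ext v
    simp only [mvfderiv, hev.mfderiv_eq]
    rfl
  rw [h1, mvfderiv_comp_apply u hgg (hd u),
    grad_comp_eq_horizontalLift (hd u) (hc.mdifferentiableAt (by simp)), mfderiv_horizontalLift hpr]

/-- The Hessian of a function that is constant on the fibers, on horizontal vectors. -/
theorem inner_covDeriv_grad_comp_lift (hpr : IsRiemannianSubmersion 𝓘(ℝ, E) 𝓘(ℝ, E') pr)
    {f : M → ℝ} (hf : ContMDiff 𝓘(ℝ, E) 𝓘(ℝ, ℝ) ∞ f) (u : N)
    (v w : TangentSpace 𝓘(ℝ, E) (pr u)) :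
    ⟪covDeriv 𝓘(ℝ, E') (grad 𝓘(ℝ, E') (f ∘ pr)) u (horizontalLift pr u v),
      horizontalLift pr u w⟫_ℝ = ⟪covDeriv 𝓘(ℝ, E) (grad 𝓘(ℝ, E) f) (pr u) v, w⟫_ℝ := by
  obtain ⟨a, ha, rfl⟩ := exists_grad_eq v
  obtain ⟨b, hb, rfl⟩ := exists_grad_eq w
  have hd := hpr.contMDiff.mdifferentiableAt (x := u) (by simp)
  have hcomp {h : M → ℝ} (hh : ContMDiffAt 𝓘(ℝ, E) 𝓘(ℝ, ℝ) ∞ h (pr u)) :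
      ContMDiffAt 𝓘(ℝ, E') 𝓘(ℝ, ℝ) ∞ (h ∘ pr) u := hh.comp u hpr.contMDiff.contMDiffAt
  have h1 := two_mul_inner_covDeriv_grad (hcomp hf.contMDiffAt) (hcomp ha) (hcomp hb)
  have h2 := two_mul_inner_covDeriv_grad (x := pr u) hf.contMDiffAt ha hb
  rw [mvfderiv_inner_grad_comp hpr hf.contMDiffAt hb ha,
    mvfderiv_inner_grad_comp hpr hf.contMDiffAt ha hb,
    mvfderiv_inner_grad_comp hpr ha hb hf.contMDiffAt,
    grad_comp_eq_horizontalLift hd (ha.mdifferentiableAt (by simp)),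
    grad_comp_eq_horizontalLift hd (hb.mdifferentiableAt (by simp))] at h1
  linarith

/-- If the Hessian of `f ∘ pr` vanishes on vertical vectors, then the Laplacians agree. -/
theorem horizontalLaplacian_comp_of_vertical (hpr : IsRiemannianSubmersion 𝓘(ℝ, E) 𝓘(ℝ, E') pr)
    {f : M → ℝ} (hf : ContMDiff 𝓘(ℝ, E) 𝓘(ℝ, ℝ) ∞ f) (u : N)
    (hv : ∀ v ∈ verticalSpace 𝓘(ℝ, E) 𝓘(ℝ, E') pr u,
      ⟪covDeriv 𝓘(ℝ, E') (grad 𝓘(ℝ, E') (f ∘ pr)) u v, v⟫_ℝ = 0) :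
    horizontalLaplacian 𝓘(ℝ, E) 𝓘(ℝ, E') pr (f ∘ pr) u = laplaceBeltrami 𝓘(ℝ, E) f (pr u) := by
  have hN := mdifferentiableAt_grad (hf.comp hpr.contMDiff).contMDiffAt (x := u)
  have hM := mdifferentiableAt_grad hf.contMDiffAt (x := pr u)
  rw [horizontalLaplacian, laplaceBeltrami, horizontalGrad_comp hpr.contMDiff hf,
    divergence_eq_trace hN, divergence_eq_trace hM]
  let T : TangentSpace 𝓘(ℝ, E') u →ₗ[ℝ] TangentSpace 𝓘(ℝ, E') u := covDerivLinear _ u hN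
  let A : TangentSpace 𝓘(ℝ, E') u →ₗ[ℝ] TangentSpace 𝓘(ℝ, E) (pr u) :=
    (mfderiv 𝓘(ℝ, E') 𝓘(ℝ, E) pr u).toLinearMap
  let L : TangentSpace 𝓘(ℝ, E) (pr u) →ₗ[ℝ] TangentSpace 𝓘(ℝ, E') u := horizontalLift pr u
  change LinearMap.trace ℝ _ T = _
  have hAL (w) : A (L w) = w := mfderiv_horizontalLift hpr u w
  have hT : covDerivLinear _ (pr u) hM = A ∘ₗ T ∘ₗ L := by
    refine LinearMap.ext fun v ↦ ext_inner_right ℝ fun w ↦ ?_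
    have h2 : ⟪L w, T (L v)⟫_ℝ = ⟪w, A (T (L v))⟫_ℝ := inner_horizontalLift u _ _
    refine (inner_covDeriv_grad_comp_lift hpr hf u v w).symm.trans ?_
    rw [LinearMap.comp_apply, LinearMap.comp_apply, real_inner_comm w, ← h2]
    exact real_inner_comm _ _
  let Q : TangentSpace 𝓘(ℝ, E') u →ₗ[ℝ] TangentSpace 𝓘(ℝ, E') u := LinearMap.id - L ∘ₗ A
  have hQA (v) : A (Q v) = 0 := by
    simp [Q, hAL]
  have hQQ : Q ∘ₗ Q = Q := by
    ext v
    simp [Q, hAL]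
  have hQs (v w) : ⟪Q v, w⟫_ℝ = ⟪v, Q w⟫_ℝ := by
    have h1 : ⟪L (A v), w⟫_ℝ = ⟪A v, A w⟫_ℝ := inner_horizontalLift u _ _
    have h2 : ⟪L (A w), v⟫_ℝ = ⟪A w, A v⟫_ℝ := inner_horizontalLift u _ _
    simp only [Q, LinearMap.sub_apply, LinearMap.id_apply, LinearMap.comp_apply, inner_sub_left,
      inner_sub_right, h1, real_inner_comm (L (A w)), h2, real_inner_comm (A w)]
  have hsplit : T = T ∘ₗ (L ∘ₗ A) + T ∘ₗ Q := by
    ext v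
    simp [Q]
  have hTQ : LinearMap.trace ℝ _ (T ∘ₗ Q) = 0 := by
    have h1 : T ∘ₗ Q = (T ∘ₗ Q) ∘ₗ Q := by rw [LinearMap.comp_assoc, hQQ]
    rw [h1, LinearMap.trace_comp_comm', LinearMap.trace_eq_sum_inner _
      (stdOrthonormalBasis ℝ (TangentSpace 𝓘(ℝ, E') u))]
    refine Finset.sum_eq_zero fun i _ ↦ ?_
    rw [LinearMap.comp_apply, LinearMap.comp_apply, ← hQs, real_inner_comm]
    exact hv _ (hQA _)
  have hTT : LinearMap.trace ℝ _ T = LinearMap.trace ℝ _ (T ∘ₗ (L ∘ₗ A)) := by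
    conv_lhs => rw [hsplit, map_add, hTQ, add_zero]
  rw [hT, hTT, ← LinearMap.comp_assoc]
  exact LinearMap.trace_comp_comm' _ _

end Lift

section ChartMap

variable {E : Type*} [NormedAddCommGroup E] [NormedSpace ℝ E] [FiniteDimensional ℝ E]
  {M : Type*} [TopologicalSpace M] [ChartedSpace E M] [IsManifold 𝓘(ℝ, E) ∞ M]
  {E' : Type*} [NormedAddCommGroup E'] [NormedSpace ℝ E'] [FiniteDimensional ℝ E']
  {N : Type*} [TopologicalSpace N] [ChartedSpace E' N] [IsManifold 𝓘(ℝ, E') ∞ N]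
  {pr : N → M} {u : N} {y : E'}

/-- A map in the charts at `u` and `pr u`. -/
noncomputable def chartMap (pr : N → M) (u : N) (y : E') : E :=
  extChartAt 𝓘(ℝ, E) (pr u) (pr ((extChartAt 𝓘(ℝ, E') u).symm y))

/-- The domain of `chartMap`. -/
def chartMapDomain (E : Type*) [NormedAddCommGroup E] [NormedSpace ℝ E] {M : Type*}
    [TopologicalSpace M] [ChartedSpace E M] {E' : Type*} [NormedAddCommGroup E']
    [NormedSpace ℝ E'] {N : Type*} [TopologicalSpace N] [ChartedSpace E' N] (pr : N → M) (u : N) :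
    Set E' :=
  (extChartAt 𝓘(ℝ, E') u).target ∩
    (extChartAt 𝓘(ℝ, E') u).symm ⁻¹' (pr ⁻¹' (chartAt E (pr u)).source)

theorem isOpen_chartMapDomain (hpr : Continuous pr) : IsOpen (chartMapDomain E (E' := E') pr u) :=
  (continuousOn_extChartAt_symm u).isOpen_inter_preimage (isOpen_extChartAt_target u)
    ((chartAt E (pr u)).open_source.preimage hpr)

theorem extChartAt_mem_chartMapDomain :
    extChartAt 𝓘(ℝ, E') u u ∈ chartMapDomain E (E' := E') pr u := by
  refine ⟨extChartAt_mem_target (mem_chart_source E' u), ?_⟩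
  rw [Set.mem_preimage, extChartAt_symm_extChartAt (mem_chart_source E' u)]
  exact mem_chart_source E (pr u)

theorem chartMap_mem_target (hy : y ∈ chartMapDomain E (E' := E') pr u) :
    chartMap pr u y ∈ (extChartAt 𝓘(ℝ, E) (pr u)).target :=
  extChartAt_mem_target hy.2

theorem contDiffOn_chartMap (hpr : ContMDiff 𝓘(ℝ, E') 𝓘(ℝ, E) ∞ pr) :
    ContDiffOn ℝ ∞ (chartMap (E := E) (E' := E') pr u) (chartMapDomain E pr u) := by
  refine ContMDiffOn.contDiffOn fun y hy ↦ ContMDiffAt.contMDiffWithinAt ?_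
  exact (contMDiffAt_extChartAt' (I := 𝓘(ℝ, E)) hy.2).comp y
    (hpr.contMDiffAt.comp y (contMDiffAt_extChartAt_symm hy.1))

theorem mfderiv_frame (hpr : ContMDiff 𝓘(ℝ, E') 𝓘(ℝ, E) ∞ pr)
    (hy : y ∈ chartMapDomain E (E' := E') pr u) (z : E') :
    mfderiv 𝓘(ℝ, E') 𝓘(ℝ, E) pr ((extChartAt 𝓘(ℝ, E') u).symm y)
        (frame u z ((extChartAt 𝓘(ℝ, E') u).symm y)) =
      frame (pr u) (fderiv ℝ (chartMap (E := E) pr u) y z)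
        (pr ((extChartAt 𝓘(ℝ, E') u).symm y)) := by
  rw [← frame_coord hy.2 (mfderiv 𝓘(ℝ, E') 𝓘(ℝ, E) pr ((extChartAt 𝓘(ℝ, E') u).symm y)
        (frame u z ((extChartAt 𝓘(ℝ, E') u).symm y)))]
  congr 1
  rw [coord_eq_mfderiv hy.2, frame_eq_mfderiv_symm hy.1]
  have hs := (contMDiffAt_extChartAt_symm hy.1).mdifferentiableAt (by simp)
  have hp := hpr.mdifferentiableAt (x := (extChartAt 𝓘(ℝ, E') u).symm y) (by simp)
  have h1 := mfderiv_comp y hp hs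
  have h2 := mfderiv_comp y (mdifferentiableAt_extChartAt (I := 𝓘(ℝ, E)) hy.2) (hp.comp y hs)
  rw [h1, mfderiv_eq_fderiv] at h2
  exact (DFunLike.congr_fun h2 z).symm

variable [Bundle.RiemannianBundle (fun x : M ↦ TangentSpace 𝓘(ℝ, E) x)]
  [IsContMDiffRiemannianBundle 𝓘(ℝ, E) ∞ E (fun x : M ↦ TangentSpace 𝓘(ℝ, E) x)]
  [Bundle.RiemannianBundle (fun x : N ↦ TangentSpace 𝓘(ℝ, E') x)]
  [IsContMDiffRiemannianBundle 𝓘(ℝ, E') ∞ E' (fun x : N ↦ TangentSpace 𝓘(ℝ, E') x)]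

/-- The horizontal lift in the charts at `u` and `pr u`. -/
noncomputable def chartLift (pr : N → M) (u : N) (y : E') (w : E) : E' :=
  (chartMetric u y).inverse
    ((chartMetric (pr u) (chartMap pr u y) w).comp (fderiv ℝ (chartMap (E := E) pr u) y))

theorem chartMetric_chartLift (hy : y ∈ chartMapDomain E (E' := E') pr u) (w : E) (z : E') :
    chartMetric u y (chartLift pr u y w) z = chartMetric (pr u) (chartMap pr u y) w
      (fderiv ℝ (chartMap (E := E) pr u) y z) := by
  rw [chartLift, chartMetric_inverse hy.1]
  rfl

theorem fderiv_chartMap_chartLift (hpr : IsRiemannianSubmersion 𝓘(ℝ, E) 𝓘(ℝ, E') pr)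
    (hy : y ∈ chartMapDomain E (E' := E') pr u) (w : E) :
    fderiv ℝ (chartMap (E := E) pr u) y (chartLift pr u y w) = w := by
  have hx := symm_mem_chart_source hy.1
  set x := (extChartAt 𝓘(ℝ, E') u).symm y with hxdef
  have hyx : extChartAt 𝓘(ℝ, E') u x = y := (extChartAt 𝓘(ℝ, E') u).right_inv hy.1
  have h1 : horizontalLift pr x (frame (pr u) w (pr x)) = frame u (chartLift pr u y w) x := by
    refine ext_inner_right ℝ fun v ↦ ?_
    rw [inner_horizontalLift, ← frame_coord hx v, mfderiv_frame hpr.contMDiff hy,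
      inner_frame hy.2, inner_frame hx, hyx, chartMetric_chartLift hy]
    rfl
  have h2 := mfderiv_horizontalLift hpr x (frame (pr u) w (pr x))
  rw [h1, mfderiv_frame hpr.contMDiff hy] at h2
  rw [← coord_frame (x := pr x) hy.2 (fderiv ℝ (chartMap (E := E) pr u) y (chartLift pr u y w)),
    h2, coord_frame (x := pr x) hy.2]

theorem fderiv_chartMap_coord (hpr : ContMDiff 𝓘(ℝ, E') 𝓘(ℝ, E) ∞ pr)
    (hy : y ∈ chartMapDomain E (E' := E') pr u)
    {x : N} (hyx : (extChartAt 𝓘(ℝ, E') u).symm y = x) {v : TangentSpace 𝓘(ℝ, E') x}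
    (hv : v ∈ verticalSpace 𝓘(ℝ, E) 𝓘(ℝ, E') pr x) :
    fderiv ℝ (chartMap (E := E) pr u) y (coord u v) = 0 := by
  subst hyx
  have h1 := mfderiv_frame hpr hy (coord u v)
  rw [frame_coord (symm_mem_chart_source hy.1)] at h1
  have h2 : mfderiv 𝓘(ℝ, E') 𝓘(ℝ, E) pr ((extChartAt 𝓘(ℝ, E') u).symm y) v = 0 := hv
  rw [← coord_frame hy.2 (fderiv ℝ (chartMap (E := E) pr u) y (coord u v)), ← h1, h2,
    coord_eq_mfderiv hy.2]
  exact map_zero _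

theorem contDiffOn_chartLift (hpr : ContMDiff 𝓘(ℝ, E') 𝓘(ℝ, E) ∞ pr) {F : Type*}
    [NormedAddCommGroup F] [NormedSpace ℝ F] {s : Set F} {Y : F → E'} {W : F → E}
    (hY : ContDiffOn ℝ ∞ Y s) (hW : ContDiffOn ℝ ∞ W s)
    (hs : Set.MapsTo Y s (chartMapDomain E pr u)) :
    ContDiffOn ℝ ∞ (fun p ↦ chartLift pr u (Y p) (W p)) s := by
  have hF := contDiffOn_chartMap (E := E) (u := u) hpr
  have hD := hF.fderiv_of_isOpen (isOpen_chartMapDomain hpr.continuous) (m := ∞) (by simp)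
  refine (contDiffOn_chartMetric_inverse.comp hY fun p hp ↦ (hs hp).1).clm_apply
    (ContDiffOn.clm_comp ?_ (hD.comp hY hs))
  exact (contDiffOn_chartMetric.comp (hF.comp hY hs)
    fun p hp ↦ chartMap_mem_target (hs hp)).clm_apply hW

/-- The acceleration of a fiber geodesic in a chart. -/
noncomputable def fiberSpray (pr : N → M) (u : N) (y v : E') : E' :=
  chartLift pr u y (fderiv ℝ (chartMap (E := E) pr u) y (christoffel u y v v) -
    fderiv ℝ (fderiv ℝ (chartMap (E := E) pr u)) y v v) - christoffel u y v v

set_option synthInstance.maxHeartbeats 200000 in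
theorem contDiffOn_fiberSpray (hpr : ContMDiff 𝓘(ℝ, E') 𝓘(ℝ, E) ∞ pr) :
    ContDiffOn ℝ ∞ (fun p : E' × E' ↦ (p.2, fiberSpray (E := E) pr u p.1 p.2))
      (chartMapDomain E pr u ×ˢ Set.univ) := by
  have hfst : ContDiffOn ℝ ∞ (Prod.fst : E' × E' → E') (chartMapDomain E pr u ×ˢ Set.univ) :=
    contDiff_fst.contDiffOn
  have hsnd : ContDiffOn ℝ ∞ (Prod.snd : E' × E' → E') (chartMapDomain E pr u ×ˢ Set.univ) :=
    contDiff_snd.contDiffOn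
  have hmaps : Set.MapsTo Prod.fst (chartMapDomain E (E' := E') pr u ×ˢ (Set.univ : Set E'))
    (chartMapDomain E (E' := E') pr u) := fun p hp ↦ hp.1
  have hΓ := contDiffOn_christoffel (x₀ := u) hfst hsnd hsnd fun p hp ↦ (hmaps hp).1
  have hopen := isOpen_chartMapDomain (E := E) (E' := E') (u := u) hpr.continuous
  have hD := (contDiffOn_chartMap (E := E) (u := u) hpr).fderiv_of_isOpen hopen (m := ∞) (by simp)
  have hD2 := hD.fderiv_of_isOpen hopen (m := ∞) (by simp)
  exact hsnd.prodMk ((contDiffOn_chartLift hpr hfst (((hD.comp hfst hmaps).clm_apply hΓ).sub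
    (((hD2.comp hfst hmaps).clm_apply hsnd).clm_apply hsnd)) hmaps).sub hΓ)

end ChartMap

section FiberGeodesic

variable {E : Type*} [NormedAddCommGroup E] [NormedSpace ℝ E] [FiniteDimensional ℝ E]
  {M : Type*} [TopologicalSpace M] [ChartedSpace E M] [IsManifold 𝓘(ℝ, E) ∞ M]
  [Bundle.RiemannianBundle (fun x : M ↦ TangentSpace 𝓘(ℝ, E) x)]
  [IsContMDiffRiemannianBundle 𝓘(ℝ, E) ∞ E (fun x : M ↦ TangentSpace 𝓘(ℝ, E) x)]
  {E' : Type*} [NormedAddCommGroup E'] [NormedSpace ℝ E'] [FiniteDimensional ℝ E']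
  {N : Type*} [TopologicalSpace N] [ChartedSpace E' N] [IsManifold 𝓘(ℝ, E') ∞ N]
  [Bundle.RiemannianBundle (fun x : N ↦ TangentSpace 𝓘(ℝ, E') x)]
  [IsContMDiffRiemannianBundle 𝓘(ℝ, E') ∞ E' (fun x : N ↦ TangentSpace 𝓘(ℝ, E') x)]
  {pr : N → M}

/-- Along an integral curve of the fiber spray, the image in the base has zero acceleration. -/
theorem hasDerivAt_fderiv_chartMap (hpr : IsRiemannianSubmersion 𝓘(ℝ, E) 𝓘(ℝ, E') pr) {u : N}
    {c v : ℝ → E'} {t : ℝ} (hc : HasDerivAt c (v t) t)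
    (hv : HasDerivAt v (fiberSpray (E := E) pr u (c t) (v t)) t)
    (ht : c t ∈ chartMapDomain E (E' := E') pr u) :
    HasDerivAt (fun s ↦ fderiv ℝ (chartMap (E := E) pr u) (c s) (v s)) 0 t := by
  have hD := ((contDiffOn_chartMap (E := E) (u := u) hpr.contMDiff).contDiffAt
    ((isOpen_chartMapDomain hpr.contMDiff.continuous).mem_nhds ht)).fderiv_right (m := ∞) (by simp)
  have h1 := ((hD.differentiableAt (by simp)).hasFDerivAt.comp_hasDerivAt t hc).clm_apply hv
  refine h1.congr_deriv ?_
  rw [fiberSpray, map_sub, Function.comp_apply, fderiv_chartMap_chartLift hpr ht]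
  abel

/-- Local existence of geodesics of the fibers. -/
theorem exists_fiberGeodesic (hpr : IsRiemannianSubmersion 𝓘(ℝ, E) 𝓘(ℝ, E') pr) {u : N}
    {v : TangentSpace 𝓘(ℝ, E') u} (hv : v ∈ verticalSpace 𝓘(ℝ, E) 𝓘(ℝ, E') pr u) :
    ∃ γ : ℝ → N, ∃ ε > 0,
      IsFiberGeodesicOn 𝓘(ℝ, E) 𝓘(ℝ, E') pr γ (Set.Ioo (-ε) ε) ∧
      (⟨γ 0, velocity 𝓘(ℝ, E') γ 0⟩ : TangentBundle 𝓘(ℝ, E') N) = ⟨u, v⟩ ∧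
      MDifferentiableAt 𝓘(ℝ, ℝ) 𝓘(ℝ, E').tangent
        (fun s ↦ (⟨γ s, velocity 𝓘(ℝ, E') γ s⟩ : TangentBundle 𝓘(ℝ, E') N)) 0 := by
  have : CompleteSpace E' := FiniteDimensional.complete ℝ E'
  have hu := mem_chart_source E' u
  have hopen := isOpen_chartMapDomain (E := E) (E' := E') (u := u) hpr.contMDiff.continuous
  obtain ⟨α, ε, hε, hα0, hαs, hα⟩ := exists_smooth_integralCurve (hopen.prod isOpen_univ)
    (contDiffOn_fiberSpray (E := E) (u := u) hpr.contMDiff)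
    (p := (extChartAt 𝓘(ℝ, E') u u, coord u v)) ⟨extChartAt_mem_chartMapDomain, trivial⟩
  obtain ⟨c, hc⟩ : ∃ c : ℝ → E', c = fun t ↦ (α t).1 := ⟨_, rfl⟩
  obtain ⟨q, hq⟩ : ∃ q : ℝ → E', q = fun t ↦ (α t).2 := ⟨_, rfl⟩
  have hc0 : c 0 = extChartAt 𝓘(ℝ, E') u u := hc ▸ congrArg Prod.fst hα0
  have hq0 : q 0 = coord u v := hq ▸ congrArg Prod.snd hα0
  have hcs : ContDiffOn ℝ ∞ c (Set.Ioo (-ε) ε) := hc ▸ contDiff_fst.comp_contDiffOn hαs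
  have hqs : ContDiffOn ℝ ∞ q (Set.Ioo (-ε) ε) := hq ▸ contDiff_snd.comp_contDiffOn hαs
  have hdom (t) (ht : t ∈ Set.Ioo (-ε) ε) : c t ∈ chartMapDomain E (E' := E') pr u :=
    hc ▸ (hα t ht).1.1
  have hcd (t) (ht : t ∈ Set.Ioo (-ε) ε) : HasDerivAt c (q t) t := by
    rw [hc, hq]
    exact (hα t ht).2.fst
  have hqd (t) (ht : t ∈ Set.Ioo (-ε) ε) :
      HasDerivAt q (fiberSpray (E := E) pr u (c t) (q t)) t := by
    rw [hc, hq]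
    exact (hα t ht).2.snd
  have h0 : (0 : ℝ) ∈ Set.Ioo (-ε) ε := ⟨by linarith, hε⟩
  have hDq (t) (ht : t ∈ Set.Ioo (-ε) ε) :
      fderiv ℝ (chartMap (E := E) pr u) (c t) (q t) = 0 := by
    refine (eq_of_hasDerivAt_zero (h := fun s ↦ fderiv ℝ (chartMap (E := E) pr u) (c s) (q s)) hε
      (fun s hs ↦ hasDerivAt_fderiv_chartMap hpr (hcd s hs) (hqd s hs) (hdom s hs)) ht).trans ?_
    simp only [hq0, hc0]
    exact fderiv_chartMap_coord hpr.contMDiff extChartAt_mem_chartMapDomain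
      (extChartAt_symm_extChartAt hu) hv
  have hFc (t) (ht : t ∈ Set.Ioo (-ε) ε) :
      chartMap (E := E) pr u (c t) = chartMap (E := E) pr u (c 0) := by
    refine eq_of_hasDerivAt_zero (h := fun s ↦ chartMap (E := E) pr u (c s)) hε (fun s hs ↦ ?_) ht
    have h1 := (((contDiffOn_chartMap (E := E) (u := u) hpr.contMDiff).contDiffAt
      (hopen.mem_nhds (hdom s hs))).differentiableAt (by simp)).hasFDerivAt.comp_hasDerivAt s
      (hcd s hs)
    rwa [hDq s hs] at h1
  set γ : ℝ → N := fun t ↦ (extChartAt 𝓘(ℝ, E') u).symm (c t) with hγ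
  have hmaps : Set.MapsTo c (Set.Ioo (-ε) ε) (extChartAt 𝓘(ℝ, E') u).target :=
    fun t ht ↦ (hdom t ht).1
  have hvel (t) (ht : t ∈ Set.Ioo (-ε) ε) :
      (⟨γ t, velocity 𝓘(ℝ, E') γ t⟩ : TangentBundle 𝓘(ℝ, E') N) =
        ⟨(extChartAt 𝓘(ℝ, E') u).symm (c t),
          frame u (q t) ((extChartAt 𝓘(ℝ, E') u).symm (c t))⟩ := by
    rw [hγ, velocity_chart_curve (hcd t ht) (hdom t ht).1]
  have hvs (t) (ht : t ∈ Set.Ioo (-ε) ε) : MDifferentiableAt 𝓘(ℝ, ℝ) 𝓘(ℝ, E').tangent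
      (fun s ↦ (⟨γ s, velocity 𝓘(ℝ, E') γ s⟩ : TangentBundle 𝓘(ℝ, E') N)) t :=
    (((contMDiffOn_frame_curve hcs hmaps hqs).congr hvel).contMDiffAt
      (isOpen_Ioo.mem_nhds ht)).mdifferentiableAt (by simp)
  refine ⟨γ, ε, hε, ⟨contMDiffOn_chart_curve hcs hmaps, ⟨pr (γ 0), fun t ht ↦ ?_⟩,
    fun t ht ↦ ?_⟩, ?_, hvs 0 h0⟩
  · rw [← extChartAt_symm_extChartAt (hdom t ht).2, ← extChartAt_symm_extChartAt (hdom 0 h0).2]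
    exact congrArg _ (hFc t ht)
  · rw [Submodule.starProjection_apply_eq_zero_iff, Submodule.mem_orthogonal']
    intro w hw
    rw [← frame_coord (x₀ := u) (symm_mem_chart_source (hdom t ht).1) w]
    refine (inner_covDerivAlong_chart_curve (hcd t ht) (hqd t ht) (hdom t ht).1
      (Filter.eventually_of_mem (isOpen_Ioo.mem_nhds ht) hvel) (hvs t ht) _).trans ?_
    rw [fiberSpray, sub_add_cancel, chartMetric_chartLift (hdom t ht),
      fderiv_chartMap_coord hpr.contMDiff (hdom t ht) rfl hw, map_zero]
  · rw [hvel 0 h0, hc0, hq0, extChartAt_symm_extChartAt hu, frame_coord hu]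

/-- If the fibers are totally geodesic, then the Hessian of `f ∘ pr` vanishes on vertical
vectors. -/
theorem inner_covDeriv_grad_comp_vertical (hpr : IsRiemannianSubmersion 𝓘(ℝ, E) 𝓘(ℝ, E') pr)
    (hfib : HasTotallyGeodesicFibers 𝓘(ℝ, E) 𝓘(ℝ, E') pr)
    {f : M → ℝ} (hf : ContMDiff 𝓘(ℝ, E) 𝓘(ℝ, ℝ) ∞ f) {u : N} {v : TangentSpace 𝓘(ℝ, E') u}
    (hv : v ∈ verticalSpace 𝓘(ℝ, E) 𝓘(ℝ, E') pr u) :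
    ⟪covDeriv 𝓘(ℝ, E') (grad 𝓘(ℝ, E') (f ∘ pr)) u v, v⟫_ℝ = 0 := by
  obtain ⟨γ, ε, hε, hγ, hγ0, hγd⟩ := exists_fiberGeodesic hpr hv
  have h0 : (0 : ℝ) ∈ Set.Ioo (-ε) ε := ⟨by linarith, hε⟩
  have hfp := hf.comp hpr.contMDiff
  have hacc := (hfib γ _ isOpen_Ioo Set.ordConnected_Ioo hγ).2 0 h0
  have h1 := hasDerivAt_inner_covDerivAlong hγd
    (mdifferentiableAt_grad (x := γ 0) hfp.contMDiffAt)
  have h2 : (fun s ↦ ⟪velocity 𝓘(ℝ, E') γ s, grad 𝓘(ℝ, E') (f ∘ pr) (γ s)⟫_ℝ) =ᶠ[nhds 0]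
      fun _ ↦ (0 : ℝ) := by
    filter_upwards [isOpen_Ioo.mem_nhds h0] with t ht
    rw [real_inner_comm, inner_grad]
    have h3 := hasDerivAt_comp_curve (hfp.mdifferentiableAt (x := γ t) (by simp))
      ((hγ.1.contMDiffAt (isOpen_Ioo.mem_nhds ht)).mdifferentiableAt (by simp))
    obtain ⟨p, hp⟩ := hγ.2.1
    refine h3.unique ((hasDerivAt_const t (f p)).congr_of_eventuallyEq ?_)
    filter_upwards [isOpen_Ioo.mem_nhds ht] with s hs
    rw [Function.comp_apply, hp s hs]
  have h4 := h1.unique ((hasDerivAt_const (0 : ℝ) (0 : ℝ)).congr_of_eventuallyEq h2)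
  have h5 : covDerivAlong 𝓘(ℝ, E') γ (velocity 𝓘(ℝ, E') γ) 0 = 0 := hacc
  rw [h5, inner_zero_left, zero_add, real_inner_comm] at h4
  exact (congrArg (fun q : TangentBundle 𝓘(ℝ, E') N ↦
    ⟪covDeriv 𝓘(ℝ, E') (grad 𝓘(ℝ, E') (f ∘ pr)) q.1 q.2, q.2⟫_ℝ) hγ0).symm.trans h4

theorem horizontalLaplacian_comp (hpr : IsRiemannianSubmersion 𝓘(ℝ, E) 𝓘(ℝ, E') pr)
    (hfib : HasTotallyGeodesicFibers 𝓘(ℝ, E) 𝓘(ℝ, E') pr)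
    {f : M → ℝ} (hf : ContMDiff 𝓘(ℝ, E) 𝓘(ℝ, ℝ) ∞ f) (u : N) :
    horizontalLaplacian 𝓘(ℝ, E) 𝓘(ℝ, E') pr (f ∘ pr) u = laplaceBeltrami 𝓘(ℝ, E) f (pr u) :=
  horizontalLaplacian_comp_of_vertical hpr hf u fun _ hv ↦
    inner_covDeriv_grad_comp_vertical hpr hfib hf hv

end FiberGeodesic

section Parallel

variable {E : Type*} [NormedAddCommGroup E] [NormedSpace ℝ E] [FiniteDimensional ℝ E]
  {M : Type*} [TopologicalSpace M] [ChartedSpace E M] [IsManifold 𝓘(ℝ, E) ∞ M]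
  [Bundle.RiemannianBundle (fun x : M ↦ TangentSpace 𝓘(ℝ, E) x)]
  [IsContMDiffRiemannianBundle 𝓘(ℝ, E) ∞ E (fun x : M ↦ TangentSpace 𝓘(ℝ, E) x)]
  {x₀ : M}

set_option synthInstance.maxHeartbeats 200000 in
theorem christoffel_sum {ι : Type*} [Fintype ι] (y v : E) (a : ι → ℝ) (W : ι → E) :
    christoffel x₀ y v (∑ j, a j • W j) = ∑ j, a j • christoffel x₀ y v (W j) := by
  have h : chartKoszul x₀ y v (∑ j, a j • W j) = ∑ j, a j • chartKoszul x₀ y v (W j) := by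
    ext z
    rw [sum_apply]
    simp only [chartKoszul_apply, map_sum, map_smul, sum_apply,
      smul_apply, smul_eq_mul, ← Finset.sum_add_distrib,
      ← Finset.sum_sub_distrib, Finset.mul_sum]
    exact Finset.sum_congr rfl fun j _ ↦ by ring
  simp only [christoffel, h, map_sum, map_smul]

theorem fderiv_chartMetric_comm {y : E} (hy : y ∈ (extChartAt 𝓘(ℝ, E) x₀).target) (u v w : E) :
    fderiv ℝ (chartMetric x₀) y u v w = fderiv ℝ (chartMetric x₀) y u w v := by
  rw [← (extChartAt 𝓘(ℝ, E) x₀).right_inv hy, ← mvfderiv_inner_frame (symm_mem_chart_source hy),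
    ← mvfderiv_inner_frame (symm_mem_chart_source hy)]
  simp only [real_inner_comm]

set_option synthInstance.maxHeartbeats 200000 in
/-- Parallel transport preserves the metric. -/
theorem hasDerivAt_chartMetric_parallel {c V W : ℝ → E} {t : ℝ} {v : E} (hc : HasDerivAt c v t)
    (hV : HasDerivAt V (-christoffel x₀ (c t) v (V t)) t)
    (hW : HasDerivAt W (-christoffel x₀ (c t) v (W t)) t)
    (ht : c t ∈ (extChartAt 𝓘(ℝ, E) x₀).target) :
    HasDerivAt (fun s ↦ chartMetric x₀ (c s) (V s) (W s)) 0 t := by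
  have hG := ((contDiffAt_chartMetric ht).differentiableAt (by simp)).hasFDerivAt.comp_hasDerivAt t
    hc
  refine ((hG.clm_apply hV).clm_apply hW).congr_deriv ?_
  simp only [Function.comp_apply, add_apply, map_neg, neg_apply]
  rw [chartMetric_christoffel ht, chartMetric_comm ht (V t), chartMetric_christoffel ht,
    chartKoszul_apply, chartKoszul_apply, fderiv_chartMetric_comm ht v (W t),
    fderiv_chartMetric_comm ht (V t), fderiv_chartMetric_comm ht (W t)]
  ring

/-- The vector field whose integral curves are the horizontal curves of frames, in a chart. -/
noncomputable def frameSpray {ι : Type*} (x₀ : M) (i : ι) (p : E × (ι → E)) : E × (ι → E) :=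
  (p.2 i, fun j ↦ -christoffel x₀ p.1 (p.2 i) (p.2 j))

theorem contDiffOn_frameSpray {ι : Type*} [Fintype ι] (i : ι) :
    ContDiffOn ℝ ∞ (frameSpray x₀ i) ((extChartAt 𝓘(ℝ, E) x₀).target ×ˢ (Set.univ : Set (ι → E))) := by
  have hj (j : ι) : ContDiffOn ℝ ∞ (fun p : E × (ι → E) ↦ p.2 j)
      ((extChartAt 𝓘(ℝ, E) x₀).target ×ˢ (Set.univ : Set (ι → E))) :=
    ((contDiff_apply ℝ E j).comp contDiff_snd).contDiffOn
  exact (hj i).prodMk (contDiffOn_pi.2 fun j ↦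
    (contDiffOn_christoffel contDiff_fst.contDiffOn (hj i) (hj j) fun p hp ↦ hp.1).neg)

end Parallel

section FrameBundle

variable {d : ℕ} {M : Type*} [TopologicalSpace M] [ChartedSpace (EuclideanSpace ℝ (Fin d)) M]
  [IsManifold (𝓡 d) ∞ M] [Bundle.RiemannianBundle (fun x : M ↦ TangentSpace (𝓡 d) x)]

theorem frame_repr_symm {x₀ x : M} (hx : x ∈ (chartAt (EuclideanSpace ℝ (Fin d)) x₀).source)
    {b : OrthonormalBasis (Fin d) ℝ (TangentSpace (𝓡 d) x)} {W : Fin d → EuclideanSpace ℝ (Fin d)}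
    (h : ∀ j, b j = frame x₀ (W j) x) (e : EuclideanSpace ℝ (Fin d)) :
    b.repr.symm e = frame x₀ (∑ j, e j • W j) x := by
  rw [← b.sum_repr_symm, frame_eq_symmL hx, map_sum]
  refine Finset.sum_congr rfl fun j _ ↦ ?_
  rw [h j, map_smul, frame_eq_symmL hx]

theorem exists_orthonormalBasis_eq {x : M} {w : Fin d → TangentSpace (𝓡 d) x}
    (hw : Orthonormal ℝ w) :
    ∃ b : OrthonormalBasis (Fin d) ℝ (TangentSpace (𝓡 d) x), ∀ j, b j = w j := by
  have hfr : Module.finrank ℝ (TangentSpace (𝓡 d) x) = Fintype.card (Fin d) := by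
    rw [Fintype.card_fin]
    exact finrank_euclideanSpace_fin
  obtain ⟨b, hb⟩ := Orthonormal.exists_orthonormalBasis_extension_of_card_eq hfr
    (v := w) (s := Set.univ) (hw.comp _ Subtype.val_injective)
  exact ⟨b, fun j ↦ hb j trivial⟩

variable [IsContMDiffRiemannianBundle (𝓡 d) ∞ (EuclideanSpace ℝ (Fin d))
    (fun x : M ↦ TangentSpace (𝓡 d) x)]

/-- A curve of frames that solves the equation of parallel transport in a chart is horizontal. -/
theorem isHorizontalCurveFrom_of_chart {i : Fin d} {u : FrameBundle d M}
    {U : ℝ → FrameBundle d M} {x₀ : M} {c : ℝ → EuclideanSpace ℝ (Fin d)}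
    {V : ℝ → Fin d → EuclideanSpace ℝ (Fin d)} {ε : ℝ} (hε : 0 < ε)
    (hcs : ContDiffOn ℝ ∞ c (Set.Ioo (-ε) ε)) (hVs : ContDiffOn ℝ ∞ V (Set.Ioo (-ε) ε))
    (hmaps : Set.MapsTo c (Set.Ioo (-ε) ε) (extChartAt (𝓡 d) x₀).target)
    (hc : ∀ t ∈ Set.Ioo (-ε) ε, HasDerivAt c (V t i) t)
    (hV : ∀ t ∈ Set.Ioo (-ε) ε, ∀ j,
      HasDerivAt (fun s ↦ V s j) (-christoffel x₀ (c t) (V t i) (V t j)) t)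
    (hU : ∀ t ∈ Set.Ioo (-ε) ε, ∀ e : EuclideanSpace ℝ (Fin d),
      (⟨(U t).1, (U t).2.repr.symm e⟩ : TangentBundle (𝓡 d) M) =
        ⟨(extChartAt (𝓡 d) x₀).symm (c t),
          frame x₀ (∑ j, e j • V t j) ((extChartAt (𝓡 d) x₀).symm (c t))⟩)
    (hU0 : U 0 = u) : IsHorizontalCurveFrom i u U := by
  have h0 : (0 : ℝ) ∈ Set.Ioo (-ε) ε := ⟨by linarith, hε⟩
  have hes (e : EuclideanSpace ℝ (Fin d)) :
      ContDiffOn ℝ ∞ (fun t ↦ ∑ j, e j • V t j) (Set.Ioo (-ε) ε) :=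
    ContDiffOn.sum fun j _ ↦ ((contDiffOn_pi.1 hVs) j).const_smul (e j)
  have hed (e : EuclideanSpace ℝ (Fin d)) (t) (ht : t ∈ Set.Ioo (-ε) ε) :
      HasDerivAt (fun t ↦ ∑ j, e j • V t j)
        (-christoffel x₀ (c t) (V t i) (∑ j, e j • V t j)) t := by
    refine (HasDerivAt.fun_sum fun j _ ↦ (hV t ht j).const_smul (e j)).congr_deriv ?_
    simp only [christoffel_sum, smul_neg, Finset.sum_neg_distrib]
  have hUs (e : EuclideanSpace ℝ (Fin d)) := (contMDiffOn_frame_curve hcs hmaps (hes e)).congr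
    fun t ht ↦ hU t ht e
  have hUd (e : EuclideanSpace ℝ (Fin d)) (t) (ht : t ∈ Set.Ioo (-ε) ε) :=
    ((hUs e).contMDiffAt (isOpen_Ioo.mem_nhds ht)).mdifferentiableAt (by simp)
  have hbase (t) (ht : t ∈ Set.Ioo (-ε) ε) : (U t).1 = (extChartAt (𝓡 d) x₀).symm (c t) :=
    congrArg Bundle.TotalSpace.proj (hU t ht 0)
  have hsrc (t) (ht : t ∈ Set.Ioo (-ε) ε) :
      (U t).1 ∈ (chartAt (EuclideanSpace ℝ (Fin d)) x₀).source := by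
    rw [hbase t ht]
    exact symm_mem_chart_source (hmaps ht)
  refine ⟨⟨ε, hε, fun e ↦ ⟨hUs e, fun t ht ↦ ext_inner_right ℝ fun w ↦ ?_⟩⟩, hU0, ?_⟩
  · rw [← frame_coord (hsrc t ht) w]
    refine (inner_covDerivAlong_chart_curve (hc t ht) (hed e t ht) (hmaps ht)
      (Filter.eventually_of_mem (isOpen_Ioo.mem_nhds ht) fun s hs ↦ hU s hs e)
      (hUd e t ht) _).trans ?_
    rw [neg_add_cancel, map_zero, inner_zero_left]
    rfl
  · have h1 : coord x₀ ((U 0).2 i) = V 0 i := by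
      have h2 := congrArg (fun q : TangentBundle (𝓡 d) M ↦ coord x₀ q.2)
        (hU 0 h0 (EuclideanSpace.single i 1))
      simp only [coord_frame (symm_mem_chart_source (hmaps h0)),
        OrthonormalBasis.repr_symm_single] at h2
      rw [h2]
      simp
    have h3 : (extChartAt (𝓡 d) x₀ ∘ fun t ↦ (U t).1) =ᶠ[nhds 0] c := by
      filter_upwards [isOpen_Ioo.mem_nhds h0] with t ht
      rw [Function.comp_apply, hbase t ht, (extChartAt (𝓡 d) x₀).right_inv (hmaps ht)]
    rw [velocity_eq_frame (hsrc 0 h0) (mdifferentiableAt_base (hUd 0 0 h0)), h3.deriv_eq,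
      (hc 0 h0).deriv, ← h1, frame_coord (hsrc 0 h0)]

/-- Local existence of horizontal curves of orthonormal frames. -/
theorem exists_isHorizontalCurveFrom (i : Fin d) (u : FrameBundle d M) :
    ∃ U, IsHorizontalCurveFrom i u U := by
  obtain ⟨p, b⟩ := u
  have hp := mem_chart_source (EuclideanSpace ℝ (Fin d)) p
  obtain ⟨α, ε, hε, hα0, hαs, hα⟩ := exists_smooth_integralCurve
    ((isOpen_extChartAt_target p).prod isOpen_univ) (contDiffOn_frameSpray (x₀ := p) i)
    (p := (extChartAt (𝓡 d) p p, fun j ↦ coord p (b j))) ⟨extChartAt_mem_target hp, trivial⟩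
  have h0 : (0 : ℝ) ∈ Set.Ioo (-ε) ε := ⟨by linarith, hε⟩
  have hmaps : Set.MapsTo (fun t ↦ (α t).1) (Set.Ioo (-ε) ε) (extChartAt (𝓡 d) p).target :=
    fun t ht ↦ (hα t ht).1.1
  have hc (t) (ht : t ∈ Set.Ioo (-ε) ε) : HasDerivAt (fun s ↦ (α s).1) ((α t).2 i) t :=
    (hα t ht).2.fst
  have hV (t) (ht : t ∈ Set.Ioo (-ε) ε) (j : Fin d) : HasDerivAt (fun s ↦ (α s).2 j)
      (-christoffel p (α t).1 ((α t).2 i) ((α t).2 j)) t :=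
    hasDerivAt_pi.1 (hα t ht).2.snd j
  have hc0 : (extChartAt (𝓡 d) p).symm (α 0).1 = p := by
    rw [hα0, extChartAt_symm_extChartAt hp]
  have hon (t) (ht : t ∈ Set.Ioo (-ε) ε) : Orthonormal ℝ
      fun j ↦ frame p ((α t).2 j) ((extChartAt (𝓡 d) p).symm (α t).1) := by
    rw [orthonormal_iff_ite]
    intro j k
    rw [← chartMetric_apply (hmaps ht)]
    refine (eq_of_hasDerivAt_zero (h := fun s ↦ chartMetric p (α s).1 ((α s).2 j) ((α s).2 k)) hε
      (fun s hs ↦ hasDerivAt_chartMetric_parallel (hc s hs) (hV s hs j) (hV s hs k) (hmaps hs))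
      ht).trans ?_
    simp only [hα0]
    rw [← inner_frame hp, frame_coord hp, frame_coord hp, orthonormal_iff_ite.1 b.orthonormal]
  have hex (t : ℝ) : ∃ q : FrameBundle d M, (t = 0 → q = ⟨p, b⟩) ∧ (t ∈ Set.Ioo (-ε) ε →
      ∀ e : EuclideanSpace ℝ (Fin d), (⟨q.1, q.2.repr.symm e⟩ : TangentBundle (𝓡 d) M) =
        ⟨(extChartAt (𝓡 d) p).symm (α t).1,
          frame p (∑ j, e j • (α t).2 j) ((extChartAt (𝓡 d) p).symm (α t).1)⟩) := by
    by_cases ht0 : t = 0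
    · subst ht0
      refine ⟨⟨p, b⟩, fun _ ↦ rfl, fun _ e ↦ ?_⟩
      rw [hc0, hα0]
      exact congrArg (Bundle.TotalSpace.mk p) (frame_repr_symm hp (fun j ↦ (frame_coord hp _).symm) e)
    · by_cases ht : t ∈ Set.Ioo (-ε) ε
      · obtain ⟨b', hb'⟩ := exists_orthonormalBasis_eq (hon t ht)
        exact ⟨⟨_, b'⟩, fun h ↦ absurd h ht0, fun _ e ↦ congrArg (Bundle.TotalSpace.mk _)
          (frame_repr_symm (symm_mem_chart_source (hmaps ht)) hb' e)⟩
      · exact ⟨⟨p, b⟩, fun _ ↦ rfl, fun h ↦ absurd h ht⟩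
  choose U hU0 hU using hex
  exact ⟨U, isHorizontalCurveFrom_of_chart hε (contDiff_fst.comp_contDiffOn hαs)
    (contDiff_snd.comp_contDiffOn hαs) hmaps hc hV hU (hU0 0 rfl)⟩

theorem hasDerivAt_comp_horizontalCurve {f : M → ℝ} (hf : ContMDiff (𝓡 d) 𝓘(ℝ, ℝ) ∞ f) {i : Fin d}
    {u : FrameBundle d M} {U : ℝ → FrameBundle d M} (hU : IsHorizontalCurveFrom i u U) :
    HasDerivAt (fun t ↦ f (U t).1) (mvfderiv (𝓡 d) f u.1 (u.2 i)) 0 := by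
  obtain ⟨⟨ε, hε, hJ⟩, rfl, hvel⟩ := hU
  have h0 : (0 : ℝ) ∈ Set.Ioo (-ε) ε := ⟨by linarith, hε⟩
  rw [← hvel]
  exact hasDerivAt_comp_curve (γ := fun t ↦ (U t).1) (hf.mdifferentiableAt (by simp))
    (mdifferentiableAt_base
      (((hJ 0).1.contMDiffAt (isOpen_Ioo.mem_nhds h0)).mdifferentiableAt (by simp)))

theorem hasDerivAt_mvfderiv_horizontalCurve {f : M → ℝ} (hf : ContMDiff (𝓡 d) 𝓘(ℝ, ℝ) ∞ f)
    {i : Fin d} {u : FrameBundle d M} {U : ℝ → FrameBundle d M}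
    (hU : IsHorizontalCurveFrom i u U) :
    HasDerivAt (fun t ↦ mvfderiv (𝓡 d) f (U t).1 ((U t).2 i))
      ⟪u.2 i, covDeriv (𝓡 d) (grad (𝓡 d) f) u.1 (u.2 i)⟫_ℝ 0 := by
  obtain ⟨⟨ε, hε, hJ⟩, rfl, hvel⟩ := hU
  have h0 : (0 : ℝ) ∈ Set.Ioo (-ε) ε := ⟨by linarith, hε⟩
  obtain ⟨hs, hp⟩ := hJ (EuclideanSpace.single i 1)
  have h1 := hasDerivAt_inner_covDerivAlong
    ((hs.contMDiffAt (isOpen_Ioo.mem_nhds h0)).mdifferentiableAt (by simp))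
    (mdifferentiableAt_grad (x := (U 0).1) hf.contMDiffAt)
  rw [hp 0 h0, inner_zero_left, zero_add, hvel] at h1
  simp only [OrthonormalBasis.repr_symm_single] at h1
  refine h1.congr_of_eventuallyEq (Filter.Eventually.of_forall fun t ↦ ?_)
  exact (inner_grad _ _ _).symm.trans (real_inner_comm _ _)

theorem isFrameHorizontalLaplacian_comp {f : M → ℝ} (hf : ContMDiff (𝓡 d) 𝓘(ℝ, ℝ) ∞ f) :
    IsFrameHorizontalLaplacian (fun w : FrameBundle d M ↦ f w.1)
      (fun w ↦ laplaceBeltrami (𝓡 d) f w.1) := by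
  refine ⟨fun i w ↦ mvfderiv (𝓡 d) f w.1 (w.2 i),
    fun i w ↦ ⟪w.2 i, covDeriv (𝓡 d) (grad (𝓡 d) f) w.1 (w.2 i)⟫_ℝ,
    fun i u ↦ ⟨exists_isHorizontalCurveFrom i u, fun U hU ↦ hasDerivAt_comp_horizontalCurve hf hU⟩,
    fun i u ↦ ⟨exists_isHorizontalCurveFrom i u, fun U hU ↦
      hasDerivAt_mvfderiv_horizontalCurve hf hU⟩, fun u ↦ ?_⟩
  have hg := mdifferentiableAt_grad (x := u.1) hf.contMDiffAt
  exact (divergence_eq_trace hg).trans (LinearMap.trace_eq_sum_inner _ u.2)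

end FrameBundle

end RiemannianSubmersion

theorem mainTheorem3 {d n : ℕ}
    {M : Type*} [TopologicalSpace M] [T2Space M] [SecondCountableTopology M]
    [ChartedSpace (EuclideanSpace ℝ (Fin d)) M] [IsManifold (𝓡 d) ∞ M]
    [Bundle.RiemannianBundle (fun x : M ↦ TangentSpace (𝓡 d) x)]
    [IsContMDiffRiemannianBundle (𝓡 d) ∞ (EuclideanSpace ℝ (Fin d))
      (fun x : M ↦ TangentSpace (𝓡 d) x)]
    {N : Type*} [TopologicalSpace N] [T2Space N] [SecondCountableTopology N]
    [ChartedSpace (EuclideanSpace ℝ (Fin n)) N] [IsManifold (𝓡 n) ∞ N]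
    [Bundle.RiemannianBundle (fun u : N ↦ TangentSpace (𝓡 n) u)]
    [IsContMDiffRiemannianBundle (𝓡 n) ∞ (EuclideanSpace ℝ (Fin n))
      (fun u : N ↦ TangentSpace (𝓡 n) u)]
    (pr : N → M)
    (hpr : RiemannianSubmersion.IsRiemannianSubmersion (𝓡 d) (𝓡 n) pr)
    (hfib : RiemannianSubmersion.HasTotallyGeodesicFibers (𝓡 d) (𝓡 n) pr)
    (hbr : RiemannianSubmersion.IsBracketGenerating (𝓡 n)
      (RiemannianSubmersion.horizontalSpace (𝓡 d) (𝓡 n) pr))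
    (f : M → ℝ) (hf : ContMDiff (𝓡 d) 𝓘(ℝ, ℝ) ∞ f) :
    (∀ u : N, RiemannianSubmersion.horizontalLaplacian (𝓡 d) (𝓡 n) pr (f ∘ pr) u =
      RiemannianSubmersion.laplaceBeltrami (𝓡 d) f (pr u)) ∧
    RiemannianSubmersion.IsFrameHorizontalLaplacian
      (fun w : RiemannianSubmersion.FrameBundle d M ↦ f w.1)
      (fun w ↦ RiemannianSubmersion.laplaceBeltrami (𝓡 d) f w.1) := by
  exact ⟨RiemannianSubmersion.horizontalLaplacian_comp hpr hfib hf,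
    RiemannianSubmersion.isFrameHorizontalLaplacian_comp hf⟩
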